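/- Write $\hat v$ for the skew-symmetric matrix with $\hat v w=v\times w$ for $w \in\mathbb R^3$, ${}^\vee$ for the inverse of $v\mapsto\hat v$, $\mathrm{Skew}(A)=\frac12(A-A^T)$, and $\|\cdot\|$ for the Euclidean (Frobenius) norm. Consider the fully actuated rigid body on $\mathrm{SO}(3)\times\mathbb R^3$, $$\dot R=R\hat\Omega,\qquad \dot\Omega=u .$$ Let $(R_0,\Omega_0):[0,\infty)\to \mathrm{SO}(3)\times\mathbb R^3$ be a reference trajectory with continuous control signal $u_0$, i.e. $\dot R_0=R_0\hat\Omega_0$, $\dot\Omega_0=u_0$ on $[0,\infty)$, and assume that $\Omega_0$ and $u_0$ are bounded on $[0,\infty)$. Along a state $(R,\Omega)$ put $$z=\mathrm{Skew}(R_0^TR)^\vee\in\mathbb R^3,\qquad \Delta\Omega=\Omega-\Omega_0,\qquad d=z\times\Omega_0+\Delta\Omega .$$ Then the controller $u=u_0+\Delta u$ makes the rigid body track $(R_0(t),\Omega_0(t))$ exponentially when $\Delta u$ is any one of the following feedback laws. 1. $\Delta u=-K_Pz-K_Dd-d\times\Omega_0-z\times u_0$, where $K_P,K_D\in\mathbb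 R^{3\times3}$ are such that $\begin{bmatrix}0&I\\-K_P&-K_D\end{bmatrix}$ is Hurwitz (all its complex eigenvalues have negative real part). 2. $\Delta u(t)=-K_Pz-K_Dd-K_I\int_{t_0}^t z(\tau)\,d\tau-d\times\Omega_0-z\times u_0$, where $t_0$ is the time at which the controller is started and $K_P,K_D,K_I\in\mathbb R^{3\times3}$ are such that all complex roots $\lambda$ of $\det(\lambda^3I+\lambda^2K_D+\lambda K_P+K_I)$ have negative real part. 3. $\Delta u=-k_Pz-K_D\Delta\Omega$, where $k_P>0$ and $K_D\in\mathbb R^{3\times3}$ is symmetric positive definite. 4. $\Delta u=-k_Pz-K_D\Delta\Omega-\epsilon\,(z\times\Omega_0)$, where $k_P>0$, $K_D\in\mathbb R^{3\times3}$ is symmetric positive definite, and $0<\epsilon<\min\left\{\sqrt{k_P},\ \dfrac{4k_P\lambda_{\min}(K_D)}{4k_P+\lambda_{\max}(K_D)^2}\right\}$. 5. $\Delta u=-k_Rz-k_\Omega\Delta\Omega+\Delta\Omega\times\Omega_0$, where $k_R,k_\Omega>0$. Here tracking exponentially is understood locally and uniformly in the starting time. With $e(t)=\big(\|R(t)-R_0(t)\|^2+\|\Omega(t)-\Omega_0(t)\|^2\big)^{1/2}$,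 it means that there are $\delta,C,c>0$ such that for every $t_0\ge0$: for every initial state in $\mathrm{SO}(3)\times\mathbb R^3$ at time $t_0$ with $e(t_0)<\delta$ a closed-loop trajectory exists on $[t_0,\infty)$; and every closed-loop trajectory, on any time interval $J$ with least element $t_0$, with $e(t_0)<\delta$ satisfies $$e(t)\le C\,e^{-c(t-t_0)}\,e(t_0)\qquad\text{for all } t\in J .$$ -/

import Mathlib

open Set MeasureTheory
open scoped Matrix Matrix.Norms.Frobenius

noncomputable section

namespace RigidBody

/-- Vectors of `ℝ³`. The Euclidean norm on them is written `‖WithLp.toLp 2 v‖`. -/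
abbrev Vec3 := Fin 3 → ℝ

/-- Real `3 × 3` matrices, with the Frobenius (Euclidean) norm. -/
abbrev Mat3 := Matrix (Fin 3) (Fin 3) ℝ

/-- `SO(3)`, as a set of matrices. -/
def SO3 : Set Mat3 := Matrix.specialOrthogonalGroup (Fin 3) ℝ

theorem mem_SO3_iff (R : Mat3) : R ∈ SO3 ↔ Rᵀ * R = 1 ∧ 0 < R.det := by
  have key : R ∈ SO3 ↔ Rᵀ * R = 1 ∧ R.det = 1 := by
    rw [← Matrix.mem_orthogonalGroup_iff' (Fin 3) ℝ]
    exact Matrix.mem_specialOrthogonalGroup_iff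
  rw [key]
  constructor
  · rintro ⟨h, hd⟩
    exact ⟨h, by rw [hd]; exact one_pos⟩
  · rintro ⟨h, hd⟩
    refine ⟨h, ?_⟩
    have h2 := congrArg Matrix.det h
    rw [Matrix.det_mul, Matrix.det_transpose, Matrix.det_one] at h2
    nlinarith

/-- The hat map `ℝ³ → 𝔰𝔬(3)`. -/
def hat (v : Vec3) : Mat3 :=
  !![0, -v 2, v 1; v 2, 0, -v 0; -v 1, v 0, 0]

/-- The vee map; on skew-symmetric matrices it is the inverse of `hat`. -/
def vee (A : Mat3) : Vec3 := ![A 2 1, A 0 2, A 1 0]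

theorem vee_hat (v : Vec3) : vee (hat v) = v := by
  ext i; fin_cases i <;> simp [vee, hat]

theorem hat_vee (A : Mat3) (hA : Aᵀ + A = 0) : hat (vee A) = A := by
  have h : ∀ i j, A j i + A i j = 0 := fun i j => by
    simpa using congrFun (congrFun hA i) j
  ext i j
  have h1 := h i j
  fin_cases i <;> fin_cases j <;> simp [vee, hat] at h1 ⊢ <;> linarith

/-- The skew-symmetric part `(A - Aᵀ) / 2` of a matrix. -/
def skewPart (A : Mat3) : Mat3 := (1 / 2 : ℝ) • (A - Aᵀ)

/-- `(R, Ω)` is, on the time set `J`, a trajectory in `SO(3) × ℝ³` of the fully actuated rigid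
body `Ṙ = R Ω̂`, `Ω̇ = u` (one-sided derivatives at end points of `J`). -/
structure IsTrajectory (J : Set ℝ) (R : ℝ → Mat3) (Ω u : ℝ → Vec3) : Prop where
  mem_SO3 : ∀ t ∈ J, R t ∈ SO3
  deriv_R : ∀ t ∈ J, HasDerivWithinAt R (R t * hat (Ω t)) J t
  deriv_Ω : ∀ t ∈ J, HasDerivWithinAt Ω (u t) J t

/-- A reference trajectory on `[0, ∞)`: a bounded trajectory driven by a bounded, continuous
control signal `u₀`. (`R₀` is automatically bounded.) -/
structure IsReference (R₀ : ℝ → Mat3) (Ω₀ u₀ : ℝ → Vec3) : Prop where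
  isTrajectory : IsTrajectory (Ici 0) R₀ Ω₀ u₀
  continuousOn_u₀ : ContinuousOn u₀ (Ici 0)
  bounded_Ω₀ : ∃ M : ℝ, ∀ t, 0 ≤ t → ‖WithLp.toLp 2 (Ω₀ t)‖ ≤ M
  bounded_u₀ : ∃ M : ℝ, ∀ t, 0 ≤ t → ‖WithLp.toLp 2 (u₀ t)‖ ≤ M

/-- The Euclidean norm of `(R - R₀, Ω - Ω₀)` in `ℝ³ˣ³ × ℝ³`. -/
def trackingError (R₀ : Mat3) (Ω₀ : Vec3) (R : Mat3) (Ω : Vec3) : ℝ :=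
  √(‖R - R₀‖ ^ 2 + ‖WithLp.toLp 2 (Ω - Ω₀)‖ ^ 2)

/-- The attitude error vector `(Skew (R₀ᵀ R))^∨` at time `t`. -/
def Zk (R₀ R : ℝ → Mat3) (t : ℝ) : Vec3 := vee (skewPart ((R₀ t)ᵀ * R t))

/-- The right-hand side `Z_k^∨ × Ω₀ + ΔΩ` of the linearized attitude error equation. -/
def linRate (R₀ : ℝ → Mat3) (Ω₀ : ℝ → Vec3) (R : ℝ → Mat3) (Ω : ℝ → Vec3) (t : ℝ) : Vec3 :=
  Zk R₀ R t ⨯₃ Ω₀ t + (Ω t - Ω₀ t)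

/-- A feedback law: to a starting time `t₀` and a state history `(R, Ω)` it assigns the
correction signal `Δu`. -/
abbrev FeedbackLaw := ℝ → (ℝ → Mat3) → (ℝ → Vec3) → ℝ → Vec3

/-- PD law with feedforward of `Ω₀` and `u₀`. -/
def lawPD (R₀ : ℝ → Mat3) (Ω₀ u₀ : ℝ → Vec3) (KP KD : Mat3) : FeedbackLaw := fun _ R Ω t =>
  -(KP *ᵥ Zk R₀ R t) - KD *ᵥ linRate R₀ Ω₀ R Ω t
    - linRate R₀ Ω₀ R Ω t ⨯₃ Ω₀ t - Zk R₀ R t ⨯₃ u₀ t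

/-- PID law with feedforward of `Ω₀` and `u₀`; the integrator starts at the starting time. -/
def lawPID (R₀ : ℝ → Mat3) (Ω₀ u₀ : ℝ → Vec3) (KP KD KI : Mat3) : FeedbackLaw := fun t₀ R Ω t =>
  -(KP *ᵥ Zk R₀ R t) - KD *ᵥ linRate R₀ Ω₀ R Ω t - KI *ᵥ (∫ s in t₀..t, Zk R₀ R s)
    - linRate R₀ Ω₀ R Ω t ⨯₃ Ω₀ t - Zk R₀ R t ⨯₃ u₀ t

/-- `Δu = -k_P Z_k^∨ - K_D ΔΩ`. -/
def lawSimple (R₀ : ℝ → Mat3) (Ω₀ : ℝ → Vec3) (kP : ℝ) (KD : Mat3) : FeedbackLaw := fun _ R Ω t =>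
  -(kP • Zk R₀ R t) - KD *ᵥ (Ω t - Ω₀ t)

/-- `Δu = -k_P Z_k^∨ - K_D ΔΩ - ε (Z_k^∨ × Ω₀)`. -/
def lawEps (R₀ : ℝ → Mat3) (Ω₀ : ℝ → Vec3) (kP ε : ℝ) (KD : Mat3) : FeedbackLaw := fun _ R Ω t =>
  -(kP • Zk R₀ R t) - KD *ᵥ (Ω t - Ω₀ t) - ε • (Zk R₀ R t ⨯₃ Ω₀ t)

/-- `Δu = -k_R Z_k^∨ - k_Ω ΔΩ + ΔΩ × Ω₀`. -/
def lawGeom (R₀ : ℝ → Mat3) (Ω₀ : ℝ → Vec3) (kR kΩ : ℝ) : FeedbackLaw := fun _ R Ω t =>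
  -(kR • Zk R₀ R t) - kΩ • (Ω t - Ω₀ t) + (Ω t - Ω₀ t) ⨯₃ Ω₀ t

/-- `(R, Ω)` is a trajectory on `J` of the closed loop with controller `u = u₀ + Δu`
started at time `t₀`. -/
def IsClosedLoop (u₀ : ℝ → Vec3) (F : FeedbackLaw) (t₀ : ℝ) (J : Set ℝ)
    (R : ℝ → Mat3) (Ω : ℝ → Vec3) : Prop :=
  IsTrajectory J R Ω (fun t => u₀ t + F t₀ R Ω t)

/-- The controller `u = u₀ + Δu` makes the rigid body track `(R₀, Ω₀)` (locally) exponentially: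
uniformly in the starting time `t₀ ≥ 0`, for every initial state with tracking error below `δ`
a closed-loop trajectory exists on `[t₀, ∞)`, and on every time interval `J` with least element
`t₀` every closed-loop trajectory with such an initial state obeys the exponential estimate. -/
def ExponentiallyTracks (R₀ : ℝ → Mat3) (Ω₀ u₀ : ℝ → Vec3) (F : FeedbackLaw) : Prop :=
  ∃ δ > 0, ∃ C > 0, ∃ c > 0, ∀ t₀ : ℝ, 0 ≤ t₀ →
    (∀ R₁ ∈ SO3, ∀ Ω₁ : Vec3, trackingError (R₀ t₀) (Ω₀ t₀) R₁ Ω₁ < δ →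
      ∃ (R : ℝ → Mat3) (Ω : ℝ → Vec3),
        IsClosedLoop u₀ F t₀ (Ici t₀) R Ω ∧ R t₀ = R₁ ∧ Ω t₀ = Ω₁) ∧
    (∀ J : Set ℝ, J.OrdConnected → IsLeast J t₀ →
      ∀ (R : ℝ → Mat3) (Ω : ℝ → Vec3), IsClosedLoop u₀ F t₀ J R Ω →
        trackingError (R₀ t₀) (Ω₀ t₀) (R t₀) (Ω t₀) < δ →
        ∀ t ∈ J, trackingError (R₀ t) (Ω₀ t) (R t) (Ω t)
          ≤ C * Real.exp (-c * (t - t₀)) * trackingError (R₀ t₀) (Ω₀ t₀) (R t₀) (Ω t₀))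

/-- A real square matrix is Hurwitz: its complex eigenvalues have negative real part. -/
def IsHurwitz {n : Type*} [Fintype n] [DecidableEq n] (A : Matrix n n ℝ) : Prop :=
  ∀ z ∈ spectrum ℂ (A.map Complex.ofReal), z.re < 0

/-- The polynomial `det (λ³ I + λ² K_D + λ K_P + K_I)` is Hurwitz: its complex roots have
negative real part. -/
def IsHurwitzPID (KP KD KI : Mat3) : Prop :=
  ∀ z : ℂ, (z ^ 3 • (1 : Matrix (Fin 3) (Fin 3) ℂ) + z ^ 2 • KD.map Complex.ofReal
    + z • KP.map Complex.ofReal + KI.map Complex.ofReal).det = 0 → z.re < 0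

/-- The smallest real eigenvalue. -/
def lambdaMin (K : Mat3) : ℝ := sInf (spectrum ℝ K)

/-- The largest real eigenvalue. -/
def lambdaMax (K : Mat3) : ℝ := sSup (spectrum ℝ K)

end RigidBody

end

open Filter Topology NNReal BoundedContinuousFunction in
/-- The weighted Picard operator has bounded integrals: an integrand growing at most like
`M exp (c (s - t₀))` has weighted integral at most `M / c`. -/
theorem norm_exp_smul_integral_le {E : Type*} [NormedAddCommGroup E] [NormedSpace ℝ E]
    {h : ℝ → E} {M c t₀ τ : ℝ} (hc : 0 < c) (hM : 0 ≤ M) (hτ : t₀ ≤ τ)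
    (hh : ∀ s, t₀ ≤ s → ‖h s‖ ≤ M * Real.exp (c * (s - t₀))) :
    ‖Real.exp (-c * (τ - t₀)) • ∫ s in t₀..τ, h s‖ ≤ M / c := by
  have hint : ∫ s in t₀..τ, M * Real.exp (c * (s - t₀))
      = M / c * (Real.exp (c * (τ - t₀)) - 1) := by
    have hd : ∀ s ∈ uIcc t₀ τ, HasDerivAt (fun s => M / c * Real.exp (c * (s - t₀)))
        (M * Real.exp (c * (s - t₀))) s := by
      intro s _
      have := ((((hasDerivAt_id s).sub_const t₀).const_mul c).exp).const_mul (M / c)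
      refine this.congr_deriv ?_
      simp only [id]
      field_simp
    rw [intervalIntegral.integral_eq_sub_of_hasDerivAt hd
      (Continuous.intervalIntegrable (by fun_prop) _ _)]
    simp
    ring
  have h1 : ‖∫ s in t₀..τ, h s‖ ≤ M / c * (Real.exp (c * (τ - t₀)) - 1) := by
    rw [← hint]
    exact intervalIntegral.norm_integral_le_of_norm_le hτ
      (ae_of_all _ fun s hs => hh s hs.1.le) (Continuous.intervalIntegrable (by fun_prop) _ _)
  rw [norm_smul, Real.norm_eq_abs, abs_of_pos (Real.exp_pos _)]
  calc Real.exp (-c * (τ - t₀)) * ‖∫ s in t₀..τ, h s‖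
      ≤ Real.exp (-c * (τ - t₀)) * (M / c * (Real.exp (c * (τ - t₀)) - 1)) := by gcongr
    _ ≤ Real.exp (-c * (τ - t₀)) * (M / c * Real.exp (c * (τ - t₀))) := by
        gcongr
        linarith
    _ = M / c := by
        rw [mul_left_comm, ← Real.exp_add]
        simp

open Filter Topology NNReal BoundedContinuousFunction in
/-- Global existence for an ODE with a vector field that is Lipschitz uniformly in time. -/
theorem exists_hasDerivAt_of_lipschitzWith {E : Type*} [NormedAddCommGroup E] [NormedSpace ℝ E]
    [CompleteSpace E] {f : ℝ → E → E} {K : ℝ≥0} {L : ℝ} (hf : Continuous (Function.uncurry f))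
    (hK : ∀ t, LipschitzWith K (f t)) (hL : ∀ t, ‖f t 0‖ ≤ L) (t₀ : ℝ) (x₀ : E) :
    ∃ y : ℝ → E, y t₀ = x₀ ∧ ∀ t, t₀ ≤ t → HasDerivAt y (f t (y t)) t := by
  set c : ℝ := K + 1 with hcdef
  have hc : 0 < c := by positivity
  have hL0 : 0 ≤ L := (norm_nonneg _).trans (hL 0)
  let F : (ℝ →ᵇ E) → ℝ → E := fun w s => f s (Real.exp (c * (s - t₀)) • w s)
  have hF : ∀ w, Continuous (F w) := fun w =>
    hf.comp (continuous_id.prodMk (Continuous.smul (by fun_prop) w.continuous))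
  have hFn : ∀ w s, t₀ ≤ s → ‖F w s‖ ≤ (L + K * ‖w‖) * Real.exp (c * (s - t₀)) := by
    intro w s hs
    have h1 := (hK s).norm_sub_le (Real.exp (c * (s - t₀)) • w s) 0
    rw [sub_zero, norm_smul, Real.norm_eq_abs, abs_of_pos (Real.exp_pos _)] at h1
    have h2 : ‖F w s‖ ≤ ‖F w s - f s 0‖ + ‖f s 0‖ := by
      simpa using norm_add_le (F w s - f s 0) (f s 0)
    have h3 : 1 ≤ Real.exp (c * (s - t₀)) :=
      Real.one_le_exp (mul_nonneg hc.le (sub_nonneg.2 hs))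
    have h4 := w.norm_coe_le_norm s
    calc ‖F w s‖ ≤ K * (Real.exp (c * (s - t₀)) * ‖w s‖) + L := by
          have := hL s
          linarith
      _ ≤ K * (Real.exp (c * (s - t₀)) * ‖w‖) + L * Real.exp (c * (s - t₀)) := by
          gcongr
          exact le_mul_of_one_le_right hL0 h3
      _ = _ := by ring
  let G : (ℝ →ᵇ E) → ℝ → E := fun w t =>
    Real.exp (-c * (max t t₀ - t₀)) • (x₀ + ∫ s in t₀..max t t₀, F w s)
  have hG : ∀ w, Continuous (G w) := fun w => by
    have h1 : Continuous fun u => ∫ s in t₀..u, F w s :=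
      intervalIntegral.continuous_primitive (fun a b => (hF w).intervalIntegrable a b) t₀
    have h2 : Continuous fun t => ∫ s in t₀..max t t₀, F w s :=
      h1.comp (continuous_id.max continuous_const)
    exact Continuous.smul (by fun_prop) (continuous_const.add h2)
  have hGn : ∀ w t, ‖G w t‖ ≤ ‖x₀‖ + (L + K * ‖w‖) / c := by
    intro w t
    simp only [G, smul_add]
    refine (norm_add_le _ _).trans (add_le_add ?_ ?_)
    · rw [norm_smul, Real.norm_eq_abs, abs_of_pos (Real.exp_pos _)]
      refine mul_le_of_le_one_left (norm_nonneg _) (Real.exp_le_one_iff.2 ?_)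
      have : 0 ≤ max t t₀ - t₀ := sub_nonneg.2 (le_max_right _ _)
      nlinarith
    · exact norm_exp_smul_integral_le hc (by positivity) (le_max_right _ _) (hFn w)
  let Φ : (ℝ →ᵇ E) → (ℝ →ᵇ E) := fun w => BoundedContinuousFunction.ofNormedAddCommGroup (G w)
    (hG w) _ (hGn w)
  have hΦ : ContractingWith (K / (K + 1)) Φ := by
    refine ⟨?_, LipschitzWith.of_dist_le_mul fun w v => ?_⟩
    · rw [div_lt_one (by positivity)]
      exact lt_add_one K
    · rw [BoundedContinuousFunction.dist_le (by positivity)]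
      intro t
      have h1 : Φ w t - Φ v t
          = Real.exp (-c * (max t t₀ - t₀)) • ∫ s in t₀..max t t₀, (F w s - F v s) := by
        simp only [Φ, BoundedContinuousFunction.coe_ofNormedAddCommGroup, G]
        rw [intervalIntegral.integral_sub ((hF w).intervalIntegrable _ _)
          ((hF v).intervalIntegrable _ _), ← smul_sub]
        congr 1
        abel
      rw [dist_eq_norm, h1]
      refine (norm_exp_smul_integral_le (M := K * dist w v) hc (by positivity)
        (le_max_right _ _) fun s _ => ?_).trans (le_of_eq ?_)
      · refine ((hK s).norm_sub_le _ _).trans ?_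
        rw [← smul_sub, norm_smul, Real.norm_eq_abs, abs_of_pos (Real.exp_pos _),
          ← dist_eq_norm]
        have := BoundedContinuousFunction.dist_coe_le_dist (f := w) (g := v) s
        calc (K : ℝ) * (Real.exp (c * (s - t₀)) * dist (w s) (v s))
            ≤ K * (Real.exp (c * (s - t₀)) * dist w v) := by gcongr
          _ = _ := by ring
      · push_cast
        ring
  set w := ContractingWith.fixedPoint Φ hΦ with hw
  have hfix : Φ w = w := hΦ.fixedPoint_isFixedPt
  refine ⟨fun t => x₀ + ∫ s in t₀..t, F w s, by simp, fun t ht => ?_⟩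
  have h1 : x₀ + ∫ s in t₀..t, F w s = Real.exp (c * (t - t₀)) • w t := by
    have h2 : w t = G w t := by
      conv_lhs => rw [← hfix]
      rfl
    rw [h2]
    simp only [G, max_eq_left ht, smul_smul, ← Real.exp_add]
    simp
  have h3 := (intervalIntegral.integral_hasDerivAt_right ((hF w).intervalIntegrable t₀ t)
    ((hF w).stronglyMeasurableAtFilter _ _) (hF w).continuousAt).const_add x₀
  convert h3 using 1
  simp only [F]
  rw [h1]

/-- First exit argument: a continuous quantity that starts below the level `r`, and is below `r`
whenever it has not exceeded `r` so far, stays below `r`. -/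
theorem forall_lt_of_first_exit {g : ℝ → ℝ} {t₀ r : ℝ} {J : Set ℝ} (hJ : J.OrdConnected)
    (ht₀ : IsLeast J t₀) (hg : ContinuousOn g J) (h0r : g t₀ < r)
    (hstep : ∀ t ∈ J, (∀ s ∈ Icc t₀ t, g s ≤ r) → g t < r) : ∀ t ∈ J, g t < r := by
  intro t₁ ht₁
  by_contra! hcon
  have hsub : Icc t₀ t₁ ⊆ J := hJ.out ht₀.1 ht₁
  have hcomp : IsCompact (Icc t₀ t₁ ∩ g ⁻¹' Ici r) :=
    isCompact_Icc.of_isClosed_subset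
      ((hg.mono hsub).preimage_isClosed_of_isClosed isClosed_Icc isClosed_Ici) inter_subset_left
  obtain ⟨s, ⟨hs, hsr⟩, hmin⟩ := hcomp.exists_isLeast ⟨t₁, ⟨ht₀.2 ht₁, le_rfl⟩, hcon⟩
  have hlt : ∀ u ∈ Ico t₀ s, g u < r := fun u hu => by
    by_contra! h
    exact absurd (hmin ⟨⟨hu.1, hu.2.le.trans hs.2⟩, h⟩) (not_le.2 hu.2)
  rcases hs.1.eq_or_lt with h0 | h0
  · subst h0
    exact absurd h0r (not_lt.2 hsr)
  · have hle : g s ≤ r := by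
      have hcl : s ∈ closure (Ico t₀ s) := by
        rw [closure_Ico h0.ne]
        exact right_mem_Icc.2 h0.le
      have hcs : ContinuousWithinAt g (Ico t₀ s) s :=
        (hg s (hsub hs)).mono fun u hu => hsub ⟨hu.1, hu.2.le.trans hs.2⟩
      have := hcs.mem_closure_image hcl
      exact (closure_minimal (by rintro _ ⟨u, hu, rfl⟩; exact (hlt u hu).le) isClosed_Iic) this
    refine absurd (hstep s (hsub hs) fun u hu => ?_) (not_lt.2 hsr)
    rcases hu.2.eq_or_lt with h | h
    · exact h ▸ hle
    · exact (hlt u ⟨hu.1, h⟩).le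

/-- Differential inequality `V' ≤ -c V` on a compact interval. -/
theorem le_exp_mul_of_hasDerivWithinAt_le {V V' : ℝ → ℝ} {t₀ T c : ℝ} (hT : t₀ ≤ T)
    (hV : ∀ t ∈ Icc t₀ T, HasDerivWithinAt V (V' t) (Icc t₀ T) t)
    (hV' : ∀ t ∈ Icc t₀ T, V' t ≤ -c * V t) :
    V T ≤ Real.exp (-c * (T - t₀)) * V t₀ := by
  have hd : ∀ t ∈ Icc t₀ T, HasDerivWithinAt (fun t => Real.exp (c * (t - t₀)) * V t)
      (Real.exp (c * (t - t₀)) * (c * V t + V' t)) (Icc t₀ T) t := by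
    intro t ht
    have h1 : HasDerivAt (fun t => Real.exp (c * (t - t₀))) (Real.exp (c * (t - t₀)) * (c * 1)) t :=
      (((hasDerivAt_id t).sub_const t₀).const_mul c).exp
    exact (h1.hasDerivWithinAt.mul (hV t ht)).congr_deriv (by ring)
  have hanti : AntitoneOn (fun t => Real.exp (c * (t - t₀)) * V t) (Icc t₀ T) := by
    refine antitoneOn_of_hasDerivWithinAt_nonpos (convex_Icc t₀ T)
      (fun t ht => (hd t ht).continuousWithinAt)
      (fun t ht => (hd t (interior_subset ht)).mono interior_subset) fun t ht => ?_
    have := hV' t (interior_subset ht)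
    exact mul_nonpos_of_nonneg_of_nonpos (Real.exp_pos _).le (by linarith)
  have h := hanti (left_mem_Icc.2 hT) (right_mem_Icc.2 hT) hT
  simp only [sub_self, mul_zero, Real.exp_zero, one_mul] at h
  calc V T = Real.exp (-c * (T - t₀)) * (Real.exp (c * (T - t₀)) * V T) := by
        rw [← mul_assoc, ← Real.exp_add]
        simp
    _ ≤ _ := by gcongr

/-- Local exponential decay from a Lyapunov function. The estimates on the Lyapunov function are
required only while the error `e` does not exceed `r`. -/
theorem sq_le_exp_mul_of_lyapunov {V V' e : ℝ → ℝ} {t₀ T a b c r : ℝ} (hT : t₀ ≤ T)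
    (ha : 0 < a) (hc : 0 ≤ c) (hr : 0 < r) (hb : 0 ≤ b)
    (he : ContinuousOn e (Icc t₀ T)) (he0 : e t₀ < r)
    (hV : ∀ t ∈ Icc t₀ T, HasDerivWithinAt V (V' t) (Icc t₀ T) t)
    (hV' : ∀ t ∈ Icc t₀ T, e t ≤ r → a * e t ^ 2 ≤ V t ∧ V' t ≤ -c * V t)
    (hinit : V t₀ ≤ b * e t₀ ^ 2) (hsmall : b * e t₀ ^ 2 < a * r ^ 2) :
    a * e T ^ 2 ≤ b * Real.exp (-c * (T - t₀)) * e t₀ ^ 2 := by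
  have key : ∀ t ∈ Icc t₀ T, (∀ s ∈ Icc t₀ t, e s ≤ r) →
      a * e t ^ 2 ≤ b * Real.exp (-c * (t - t₀)) * e t₀ ^ 2 := by
    intro t ht hle
    have hsub : Icc t₀ t ⊆ Icc t₀ T := Icc_subset_Icc_right ht.2
    have h1 := le_exp_mul_of_hasDerivWithinAt_le ht.1
      (fun s hs => (hV s (hsub hs)).mono hsub) (fun s hs => (hV' s (hsub hs) (hle s hs)).2)
    calc a * e t ^ 2 ≤ V t := (hV' t ht (hle t (right_mem_Icc.2 ht.1))).1
      _ ≤ Real.exp (-c * (t - t₀)) * V t₀ := h1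
      _ ≤ Real.exp (-c * (t - t₀)) * (b * e t₀ ^ 2) := by gcongr
      _ = _ := by ring
  have hlt : ∀ t ∈ Icc t₀ T, e t < r := by
    refine forall_lt_of_first_exit ordConnected_Icc (isLeast_Icc hT) he he0 fun t ht hle => ?_
    have h1 := key t ht hle
    have h2 : Real.exp (-c * (t - t₀)) ≤ 1 := by
      rw [Real.exp_le_one_iff]
      nlinarith [ht.1]
    have h3 : b * Real.exp (-c * (t - t₀)) * e t₀ ^ 2 ≤ b * e t₀ ^ 2 := by
      have : 0 ≤ b * e t₀ ^ 2 := by positivity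
      nlinarith
    have h4 : e t ^ 2 < r ^ 2 := lt_of_mul_lt_mul_left (h1.trans_lt (h3.trans_lt hsmall)) ha.le
    exact lt_of_pow_lt_pow_left₀ 2 hr.le h4
  exact key T (right_mem_Icc.2 hT) fun s hs => (hlt s hs).le

/-- The Euclidean norm of a real vector. -/
notation "‖" v "‖₂" => norm (WithLp.toLp 2 v)

theorem dotProduct_self_eq_norm_sq {n : Type*} [Fintype n] (x : n → ℝ) :
    x ⬝ᵥ x = ‖x‖₂ ^ 2 := by
  rw [EuclideanSpace.real_norm_sq_eq]
  simp [dotProduct, sq]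

theorem abs_dotProduct_le {n : Type*} [Fintype n] (x y : n → ℝ) :
    |x ⬝ᵥ y| ≤ ‖x‖₂ * ‖y‖₂ := by
  have h := abs_real_inner_le_norm (WithLp.toLp 2 y) (WithLp.toLp 2 x)
  rw [EuclideanSpace.inner_toLp_toLp] at h
  simpa [mul_comm] using h

theorem norm_toLp_mulVec_le {m n : Type*} [Fintype m] [Fintype n] (M : Matrix m n ℝ) (x : n → ℝ) :
    ‖M *ᵥ x‖₂ ≤ ‖M‖ * ‖x‖₂ := by
  rw [← Matrix.frobenius_norm_replicateCol (ι := Unit),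
    ← Matrix.frobenius_norm_replicateCol (ι := Unit), Matrix.replicateCol_mulVec]
  exact Matrix.frobenius_norm_mul _ _

open Filter Topology in
/-- An explicit Euler step of a Hurwitz system with a small step size is power contracting. -/
theorem exists_norm_one_add_smul_pow_lt_one {n : Type*} [Fintype n] [DecidableEq n] [Nonempty n]
    (A : Matrix n n ℂ) (hA : ∀ z ∈ spectrum ℂ A, z.re < 0) :
    ∃ h : ℝ, 0 < h ∧ ∃ N : ℕ, 0 < N ∧ ‖(1 + (h : ℂ) • A) ^ N‖ < 1 := by
  obtain ⟨z₁, hz₁, hmax⟩ := (spectrum.isCompact A).exists_isMaxOn (spectrum.nonempty A)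
    Complex.continuous_re.continuousOn
  obtain ⟨L, hL⟩ := (spectrum.isCompact (𝕜 := ℂ) A).isBounded.exists_norm_le
  set α := -z₁.re with hα
  have hα0 : 0 < α := neg_pos.2 (hA _ hz₁)
  set h := α / (L ^ 2 + 1) with hh
  have hpos : 0 < h := by positivity
  have hlt : ∀ z ∈ spectrum ℂ (1 + (h : ℂ) • A), ‖z‖₊ < 1 := by
    intro z hz
    have hz' : (z - 1) / h ∈ spectrum ℂ A := by
      have hne : (h : ℂ) ≠ 0 := by exact_mod_cast hpos.ne'
      rw [spectrum.mem_iff] at hz ⊢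
      refine fun hu => hz ?_
      have h1 := ((IsUnit.mk0 _ hne).map (algebraMap ℂ (Matrix n n ℂ))).mul hu
      rw [mul_sub, ← map_mul, mul_div_cancel₀ _ hne, map_sub, map_one, sub_sub,
        ← Algebra.smul_def] at h1
      exact h1
    set w := (z - 1) / h with hw
    have hzw : z = 1 + h * w := by
      have hne : (h : ℂ) ≠ 0 := by exact_mod_cast hpos.ne'
      rw [hw]
      field_simp
      ring
    have h1 : w.re ≤ -α := by
      have := hmax hz'
      simp only [mem_ofPred_eq] at this
      linarith
    have h2 : w.re ^ 2 + w.im ^ 2 ≤ L ^ 2 := by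
      have h3 := hL w hz'
      have h4 : ‖w‖ ^ 2 ≤ L ^ 2 := by gcongr
      rw [Complex.sq_norm, Complex.normSq_apply] at h4
      nlinarith
    have h3 : ‖z‖ ^ 2 < 1 := by
      rw [Complex.sq_norm, Complex.normSq_apply, hzw]
      simp only [Complex.add_re, Complex.one_re, Complex.mul_re, Complex.ofReal_re,
        Complex.ofReal_im, zero_mul, sub_zero, Complex.add_im, Complex.one_im, Complex.mul_im,
        zero_add, add_zero]
      have h4 : h * (L ^ 2 + 1) = α := by
        rw [hh]
        field_simp
      have h5 : (1 + h * w.re) * (1 + h * w.re) + h * w.im * (h * w.im)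
          = 1 + 2 * h * w.re + h ^ 2 * (w.re ^ 2 + w.im ^ 2) := by ring
      rw [h5]
      have h6 : h ^ 2 * (w.re ^ 2 + w.im ^ 2) ≤ h * (h * (L ^ 2 + 1)) := by
        rw [← mul_assoc, ← sq]
        exact mul_le_mul_of_nonneg_left (by linarith) (sq_nonneg h)
      rw [h4] at h6
      have h7 : h * w.re ≤ h * -α := by gcongr
      nlinarith
    have h4 : ‖z‖ < 1 := by nlinarith [norm_nonneg z]
    exact_mod_cast h4
  have hrad := spectrum.spectralRadius_lt_of_forall_lt _ hlt
  have htend := spectrum.pow_nnnorm_pow_one_div_tendsto_nhds_spectralRadius (1 + (h : ℂ) • A)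
  obtain ⟨N, hN, hN0⟩ := ((htend.eventually_lt_const hrad).and (eventually_gt_atTop 0)).exists
  refine ⟨h, hpos, N, hN0, ?_⟩
  have hN' : (0 : ℝ) < 1 / N := by positivity
  rw [ENNReal.coe_one] at hN
  by_contra! hcon
  refine absurd hN (not_lt.2 (ENNReal.one_le_rpow ?_ hN'))
  exact_mod_cast hcon

/-- **Lyapunov's theorem**: a Hurwitz matrix has a quadratic Lyapunov function. -/
theorem RigidBody.IsHurwitz.exists_lyapunov {n : Type*} [Fintype n] [DecidableEq n] [Nonempty n]
    {A : Matrix n n ℝ} (hA : RigidBody.IsHurwitz A) :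
    ∃ P : Matrix n n ℝ, Pᵀ = P ∧ (∀ x, x ⬝ᵥ x ≤ x ⬝ᵥ P *ᵥ x) ∧
      ∃ η : ℝ, 0 < η ∧ ∀ x, 2 * (x ⬝ᵥ P *ᵥ (A *ᵥ x)) ≤ -η * (x ⬝ᵥ x) := by
  obtain ⟨h, hh, N, hN, hlt⟩ := exists_norm_one_add_smul_pow_lt_one _ hA
  set B : Matrix n n ℝ := 1 + h • A with hB
  have hBN : ‖B ^ N‖ < 1 := by
    have h1 : (1 + (h : ℂ) • A.map Complex.ofReal) = Complex.ofRealHom.mapMatrix B := by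
      ext i j
      by_cases hij : i = j <;> simp [hB, hij]
    rw [h1, ← map_pow] at hlt
    refine lt_of_eq_of_lt (Eq.symm ?_) hlt
    exact Matrix.frobenius_norm_map_eq _ _ fun a => by simp
  have hdot : ∀ x y, x ⬝ᵥ (∑ k ∈ Finset.range N, (B ^ k)ᵀ * B ^ k) *ᵥ y
      = ∑ k ∈ Finset.range N, (B ^ k *ᵥ x) ⬝ᵥ (B ^ k *ᵥ y) := by
    intro x y
    rw [Matrix.sum_mulVec, dotProduct_sum]
    refine Finset.sum_congr rfl fun k _ => ?_
    rw [← Matrix.mulVec_mulVec, Matrix.dotProduct_mulVec, Matrix.vecMul_transpose]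
  refine ⟨∑ k ∈ Finset.range N, (B ^ k)ᵀ * B ^ k, ?_, fun x => ?_, (1 - ‖B ^ N‖ ^ 2) / h, ?_,
    fun x => ?_⟩
  · simp [Matrix.transpose_sum, Matrix.transpose_mul]
  · rw [hdot]
    have h1 := Finset.single_le_sum (f := fun k => (B ^ k *ᵥ x) ⬝ᵥ (B ^ k *ᵥ x))
      (fun k _ => by rw [dotProduct_self_eq_norm_sq]; positivity) (Finset.mem_range.2 hN)
    simpa using h1
  · refine div_pos ?_ hh
    nlinarith [norm_nonneg (B ^ N)]
  · rw [hdot]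
    have h1 : ∑ k ∈ Finset.range N, ((B ^ (k + 1) *ᵥ x) ⬝ᵥ (B ^ (k + 1) *ᵥ x)
        - (B ^ k *ᵥ x) ⬝ᵥ (B ^ k *ᵥ x)) = (B ^ N *ᵥ x) ⬝ᵥ (B ^ N *ᵥ x) - x ⬝ᵥ x := by
      rw [Finset.sum_range_sub (fun k => (B ^ k *ᵥ x) ⬝ᵥ (B ^ k *ᵥ x))]
      simp
    have h2 : ∀ k, (B ^ (k + 1) *ᵥ x) ⬝ᵥ (B ^ (k + 1) *ᵥ x) - (B ^ k *ᵥ x) ⬝ᵥ (B ^ k *ᵥ x)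
        = 2 * h * ((B ^ k *ᵥ x) ⬝ᵥ (B ^ k *ᵥ (A *ᵥ x)))
          + h ^ 2 * ((B ^ k *ᵥ (A *ᵥ x)) ⬝ᵥ (B ^ k *ᵥ (A *ᵥ x))) := by
      intro k
      have h3 : B ^ (k + 1) *ᵥ x = B ^ k *ᵥ x + h • (B ^ k *ᵥ (A *ᵥ x)) := by
        rw [pow_succ, ← Matrix.mulVec_mulVec, hB, Matrix.add_mulVec, Matrix.one_mulVec,
          Matrix.mulVec_add, Matrix.smul_mulVec, Matrix.mulVec_smul]
      rw [h3]
      simp only [add_dotProduct, dotProduct_add, smul_dotProduct, dotProduct_smul, smul_eq_mul,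
        dotProduct_comm (B ^ k *ᵥ (A *ᵥ x)) (B ^ k *ᵥ x)]
      ring
    have h3 : 0 ≤ ∑ k ∈ Finset.range N, h ^ 2 * ((B ^ k *ᵥ (A *ᵥ x)) ⬝ᵥ (B ^ k *ᵥ (A *ᵥ x))) :=
      Finset.sum_nonneg fun k _ => by rw [dotProduct_self_eq_norm_sq]; positivity
    simp only [h2, Finset.sum_add_distrib, ← Finset.mul_sum] at h1 h3
    have h4 : (B ^ N *ᵥ x) ⬝ᵥ (B ^ N *ᵥ x) ≤ ‖B ^ N‖ ^ 2 * (x ⬝ᵥ x) := by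
      rw [dotProduct_self_eq_norm_sq, dotProduct_self_eq_norm_sq, ← mul_pow]
      gcongr
      exact norm_toLp_mulVec_le _ _
    rw [neg_mul, div_mul_eq_mul_div, ← neg_div, le_div_iff₀ hh]
    nlinarith

namespace RigidBody

theorem norm_sq_fin_three (v : Vec3) : ‖v‖₂ ^ 2 = v 0 ^ 2 + v 1 ^ 2 + v 2 ^ 2 := by
  rw [← dotProduct_self_eq_norm_sq]
  simp [dotProduct, Fin.sum_univ_three, sq]

theorem frobenius_norm_sq {m n : Type*} [Fintype m] [Fintype n] (A : Matrix m n ℝ) :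
    ‖A‖ ^ 2 = (Aᵀ * A).trace := by
  rw [Matrix.frobenius_norm_def, ← Real.sqrt_eq_rpow, Real.sq_sqrt (by positivity)]
  simp only [Matrix.trace, Matrix.diag, Matrix.mul_apply, Matrix.transpose_apply]
  rw [Finset.sum_comm]
  simp [sq]

theorem frobenius_norm_sq_fin_three (A : Mat3) : ‖A‖ ^ 2 = A 0 0 ^ 2 + A 0 1 ^ 2 + A 0 2 ^ 2
    + (A 1 0 ^ 2 + A 1 1 ^ 2 + A 1 2 ^ 2) + (A 2 0 ^ 2 + A 2 1 ^ 2 + A 2 2 ^ 2) := by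
  rw [Matrix.frobenius_norm_def, ← Real.sqrt_eq_rpow, Real.sq_sqrt (by positivity)]
  simp [Fin.sum_univ_three]

theorem SO3.transpose_mul {R : Mat3} (hR : R ∈ SO3) : Rᵀ * R = 1 := ((mem_SO3_iff R).1 hR).1

theorem SO3.mul_transpose {R : Mat3} (hR : R ∈ SO3) : R * Rᵀ = 1 :=
  mul_eq_one_comm.1 (SO3.transpose_mul hR)

theorem norm_transpose_mul_of_mem_SO3 {R : Mat3} (hR : R ∈ SO3) (A : Mat3) : ‖Rᵀ * A‖ = ‖A‖ := by
  refine (sq_eq_sq₀ (norm_nonneg _) (norm_nonneg _)).1 ?_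
  rw [frobenius_norm_sq, frobenius_norm_sq, Matrix.transpose_mul, Matrix.transpose_transpose,
    Matrix.mul_assoc, ← Matrix.mul_assoc R, SO3.mul_transpose hR, Matrix.one_mul]

theorem norm_transpose_mul_sub_one {R₀ R : Mat3} (h₀ : R₀ ∈ SO3) : ‖R₀ᵀ * R - 1‖ = ‖R - R₀‖ := by
  rw [← SO3.transpose_mul h₀, ← Matrix.mul_sub, norm_transpose_mul_of_mem_SO3 h₀]

/-- `A ↦ (Skew A)^∨` as a continuous linear map. -/
noncomputable def veeSkew : Mat3 →L[ℝ] Vec3 := LinearMap.toContinuousLinearMap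
  { toFun := fun A => vee (skewPart A)
    map_add' := fun A B => by
      ext i; fin_cases i <;> simp [vee, skewPart] <;> ring
    map_smul' := fun c A => by
      ext i; fin_cases i <;> simp [vee, skewPart] <;> ring }

theorem veeSkew_apply (A : Mat3) : veeSkew A = vee (skewPart A) := rfl

theorem Zk_eq (R₀ R : ℝ → Mat3) (t : ℝ) : Zk R₀ R t = veeSkew ((R₀ t)ᵀ * R t) := rfl

theorem norm_veeSkew_le (A : Mat3) : ‖veeSkew A‖₂ ≤ ‖A‖ := by
  refine (sq_le_sq₀ (norm_nonneg _) (norm_nonneg _)).1 ?_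
  rw [norm_sq_fin_three, frobenius_norm_sq_fin_three]
  simp [veeSkew_apply, vee, skewPart]
  nlinarith [sq_nonneg (A 2 1 + A 1 2), sq_nonneg (A 0 2 + A 2 0), sq_nonneg (A 1 0 + A 0 1),
    sq_nonneg (A 2 1), sq_nonneg (A 1 2), sq_nonneg (A 0 2), sq_nonneg (A 2 0), sq_nonneg (A 1 0),
    sq_nonneg (A 0 1), sq_nonneg (A 0 0), sq_nonneg (A 1 1), sq_nonneg (A 2 2)]

theorem norm_hat_le (v : Vec3) : ‖hat v‖ ≤ 2 * ‖v‖₂ := by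
  refine (sq_le_sq₀ (norm_nonneg _) (by positivity)).1 ?_
  rw [mul_pow, norm_sq_fin_three, frobenius_norm_sq_fin_three]
  simp [hat]
  nlinarith [sq_nonneg (v 0), sq_nonneg (v 1), sq_nonneg (v 2)]

theorem norm_sub_transpose_le (A : Mat3) : ‖A - Aᵀ‖ ≤ 3 * ‖veeSkew A‖₂ := by
  refine (sq_le_sq₀ (norm_nonneg _) (by positivity)).1 ?_
  rw [mul_pow, norm_sq_fin_three, frobenius_norm_sq_fin_three]
  simp [veeSkew_apply, vee, skewPart]
  nlinarith [sq_nonneg (A 2 1 - A 1 2), sq_nonneg (A 0 2 - A 2 0), sq_nonneg (A 1 0 - A 0 1)]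

/-- Near the identity, a rotation is controlled by its skew-symmetric part. -/
theorem norm_sub_one_le {E : Mat3} (hE : E * Eᵀ = 1) (h1 : ‖E - 1‖ ≤ 1) :
    ‖E - 1‖ ≤ 3 * ‖veeSkew E‖₂ := by
  have h2 : (2 : ℝ) • (E - 1) = (E - Eᵀ) - (E - 1) * (E - 1)ᵀ := by
    rw [Matrix.transpose_sub, Matrix.transpose_one, sub_mul, mul_sub, hE, two_smul]
    simp only [mul_one, one_mul]
    abel
  have h3 : 2 * ‖E - 1‖ ≤ ‖E - Eᵀ‖ + ‖E - 1‖ * ‖E - 1‖ := by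
    calc 2 * ‖E - 1‖ = ‖(2 : ℝ) • (E - 1)‖ := by rw [norm_smul]; norm_num
      _ ≤ ‖E - Eᵀ‖ + ‖(E - 1) * (E - 1)ᵀ‖ := h2 ▸ norm_sub_le _ _
      _ ≤ ‖E - Eᵀ‖ + ‖E - 1‖ * ‖E - 1‖ := by
        gcongr
        refine (norm_mul_le _ _).trans_eq ?_
        rw [Matrix.frobenius_norm_transpose]
  nlinarith [norm_sub_transpose_le E, norm_nonneg (E - 1)]

theorem norm_cross_le (v w : Vec3) : ‖v ⨯₃ w‖₂ ≤ ‖v‖₂ * ‖w‖₂ := by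
  refine (sq_le_sq₀ (norm_nonneg _) (by positivity)).1 ?_
  rw [mul_pow, ← dotProduct_self_eq_norm_sq, ← dotProduct_self_eq_norm_sq,
    ← dotProduct_self_eq_norm_sq, cross_dot_cross, dotProduct_comm w v]
  nlinarith [mul_self_nonneg (v ⬝ᵥ w)]

theorem hat_mulVec (v w : Vec3) : hat v *ᵥ w = v ⨯₃ w := by
  ext i
  fin_cases i <;> simp [hat, cross_apply, Matrix.mulVec, dotProduct, Fin.sum_univ_three] <;> ring

theorem transpose_hat (v : Vec3) : (hat v)ᵀ = -hat v := by
  ext i j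
  fin_cases i <;> fin_cases j <;> simp [hat]

/-- The attitude error equation, split into its linear part and a quadratic remainder. -/
theorem veeSkew_errorRate (E : Mat3) (v w : Vec3) :
    veeSkew (-(hat w * E) + E * hat v)
      = veeSkew E ⨯₃ w + (v - w) + veeSkew ((E - 1) * hat (v - w)) := by
  ext i
  fin_cases i <;>
    simp [veeSkew_apply, vee, skewPart, hat, cross_apply, Matrix.mul_apply, Fin.sum_univ_three,
      Matrix.vecMul, dotProduct, Matrix.vecHead, Matrix.vecTail] <;>
    ring

theorem _root_.HasDerivWithinAt.crossProduct {v w : ℝ → Vec3} {v' w' : Vec3} {J : Set ℝ} {t : ℝ}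
    (hv : HasDerivWithinAt v v' J t) (hw : HasDerivWithinAt w w' J t) :
    HasDerivWithinAt (fun t => v t ⨯₃ w t) (v' ⨯₃ w t + v t ⨯₃ w') J t := by
  rw [hasDerivWithinAt_pi] at hv hw ⊢
  intro i
  have key : ∀ j k : Fin 3, HasDerivWithinAt (fun t => v t j * w t k - v t k * w t j)
      (v' j * w t k + v t j * w' k - (v' k * w t j + v t k * w' j)) J t := fun j k =>
    ((hv j).mul (hw k)).sub ((hv k).mul (hw j))
  fin_cases i
  · refine (key 1 2).congr_deriv ?_
    simp [cross_apply]
    ring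
  · refine (key 2 0).congr_deriv ?_
    simp [cross_apply]
    ring
  · refine (key 0 1).congr_deriv ?_
    simp [cross_apply]
    ring

theorem _root_.HasDerivWithinAt.matrix_transpose {R : ℝ → Mat3} {R' : Mat3} {J : Set ℝ} {t : ℝ}
    (hR : HasDerivWithinAt R R' J t) : HasDerivWithinAt (fun t => (R t)ᵀ) R'ᵀ J t :=
  (LinearMap.toContinuousLinearMap
    (Matrix.transposeLinearEquiv (Fin 3) (Fin 3) ℝ ℝ).toLinearMap).hasFDerivAt.comp_hasDerivWithinAt
    t hR

theorem hasDerivWithinAt_Zk {R₀ R : ℝ → Mat3} {Ω₀ Ω u₀ u : ℝ → Vec3} {J : Set ℝ} {t : ℝ}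
    (h₀ : IsTrajectory J R₀ Ω₀ u₀) (h : IsTrajectory J R Ω u) (ht : t ∈ J) :
    HasDerivWithinAt (Zk R₀ R) (linRate R₀ Ω₀ R Ω t
      + veeSkew (((R₀ t)ᵀ * R t - 1) * hat (Ω t - Ω₀ t))) J t := by
  have h1 := ((h₀.deriv_R t ht).matrix_transpose).mul (h.deriv_R t ht)
  have h2 := veeSkew.hasFDerivAt.comp_hasDerivWithinAt t h1
  refine h2.congr_deriv ?_
  rw [linRate, Zk_eq, ← veeSkew_errorRate, Matrix.transpose_mul, transpose_hat]
  simp only [Matrix.neg_mul, Matrix.mul_assoc]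
  rfl

end RigidBody

theorem HasDerivWithinAt.dotProduct {n : Type*} [Fintype n] {x y : ℝ → n → ℝ} {x' y' : n → ℝ}
    {J : Set ℝ} {t : ℝ} (hx : HasDerivWithinAt x x' J t) (hy : HasDerivWithinAt y y' J t) :
    HasDerivWithinAt (fun t => x t ⬝ᵥ y t) (x' ⬝ᵥ y t + x t ⬝ᵥ y') J t := by
  rw [hasDerivWithinAt_pi] at hx hy
  have h := HasDerivWithinAt.fun_sum (u := Finset.univ) fun i _ => (hx i).mul (hy i)
  refine h.congr_deriv ?_
  rw [Finset.sum_add_distrib]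
  rfl

theorem HasDerivWithinAt.const_mulVec {m n : Type*} [Fintype m] [Fintype n] (A : Matrix m n ℝ)
    {x : ℝ → n → ℝ} {x' : n → ℝ} {J : Set ℝ} {t : ℝ} (hx : HasDerivWithinAt x x' J t) :
    HasDerivWithinAt (fun t => A *ᵥ x t) (A *ᵥ x') J t :=
  (LinearMap.toContinuousLinearMap A.mulVecLin).hasFDerivAt.comp_hasDerivWithinAt t hx

namespace RigidBody

theorem IsTrajectory.mono {J J' : Set ℝ} {R : ℝ → Mat3} {Ω u : ℝ → Vec3}
    (h : IsTrajectory J R Ω u) (hJ : J' ⊆ J) : IsTrajectory J' R Ω u :=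
  ⟨fun t ht => h.mem_SO3 t (hJ ht), fun t ht => (h.deriv_R t (hJ ht)).mono hJ,
    fun t ht => (h.deriv_Ω t (hJ ht)).mono hJ⟩

theorem IsTrajectory.continuousOn_R {J : Set ℝ} {R : ℝ → Mat3} {Ω u : ℝ → Vec3}
    (h : IsTrajectory J R Ω u) : ContinuousOn R J := fun t ht => (h.deriv_R t ht).continuousWithinAt

theorem IsTrajectory.continuousOn_Ω {J : Set ℝ} {R : ℝ → Mat3} {Ω u : ℝ → Vec3}
    (h : IsTrajectory J R Ω u) : ContinuousOn Ω J := fun t ht => (h.deriv_Ω t ht).continuousWithinAt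

theorem IsReference.isTrajectory_Icc {R₀ : ℝ → Mat3} {Ω₀ u₀ : ℝ → Vec3}
    (h : IsReference R₀ Ω₀ u₀) {t₀ T : ℝ} (ht₀ : 0 ≤ t₀) : IsTrajectory (Icc t₀ T) R₀ Ω₀ u₀ :=
  h.isTrajectory.mono fun _ ht => ht₀.trans ht.1

theorem trackingError_nonneg (R₀ : Mat3) (Ω₀ : Vec3) (R : Mat3) (Ω : Vec3) :
    0 ≤ trackingError R₀ Ω₀ R Ω := Real.sqrt_nonneg _

theorem trackingError_sq (R₀ : Mat3) (Ω₀ : Vec3) (R : Mat3) (Ω : Vec3) :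
    trackingError R₀ Ω₀ R Ω ^ 2 = ‖R - R₀‖ ^ 2 + ‖Ω - Ω₀‖₂ ^ 2 := Real.sq_sqrt (by positivity)

theorem norm_sub_le_trackingError (R₀ : Mat3) (Ω₀ : Vec3) (R : Mat3) (Ω : Vec3) :
    ‖R - R₀‖ ≤ trackingError R₀ Ω₀ R Ω :=
  Real.le_sqrt_of_sq_le (by nlinarith [norm_nonneg (WithLp.toLp 2 (Ω - Ω₀))])

theorem norm_sub_le_trackingError' (R₀ : Mat3) (Ω₀ : Vec3) (R : Mat3) (Ω : Vec3) :
    ‖Ω - Ω₀‖₂ ≤ trackingError R₀ Ω₀ R Ω :=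
  Real.le_sqrt_of_sq_le (by nlinarith [norm_nonneg (R - R₀)])

theorem continuousOn_trackingError {J : Set ℝ} {R₀ R : ℝ → Mat3} {Ω₀ Ω u₀ u : ℝ → Vec3}
    (h₀ : IsTrajectory J R₀ Ω₀ u₀) (h : IsTrajectory J R Ω u) :
    ContinuousOn (fun t => trackingError (R₀ t) (Ω₀ t) (R t) (Ω t)) J := by
  have h1 := (h.continuousOn_R.sub h₀.continuousOn_R).norm
  have h2 := ((PiLp.continuous_toLp 2 (fun _ : Fin 3 => ℝ)).comp_continuousOn
    (h.continuousOn_Ω.sub h₀.continuousOn_Ω)).norm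
  exact ((h1.pow 2).add (h2.pow 2)).sqrt

theorem norm_Zk_le {R₀ R : ℝ → Mat3} {t : ℝ} (h₀ : R₀ t ∈ SO3) : ‖Zk R₀ R t‖₂ ≤ ‖R t - R₀ t‖ := by
  have h : Zk R₀ R t = veeSkew ((R₀ t)ᵀ * R t - 1) := by
    rw [map_sub, Zk_eq]
    have : veeSkew 1 = 0 := by
      ext i
      fin_cases i <;> simp [veeSkew_apply, vee, skewPart]
    rw [this, sub_zero]
  rw [h, ← norm_transpose_mul_sub_one h₀]
  exact norm_veeSkew_le _

/-- The exponential tracking estimate, uniformly over all closed-loop trajectories on compact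
intervals. -/
def HasExponentialEstimate (R₀ : ℝ → Mat3) (Ω₀ u₀ : ℝ → Vec3) (F : FeedbackLaw) : Prop :=
  ∃ δ > 0, ∃ C > 0, ∃ c > 0, ∀ t₀ : ℝ, 0 ≤ t₀ → ∀ T, t₀ ≤ T → ∀ (R : ℝ → Mat3) (Ω : ℝ → Vec3),
    IsClosedLoop u₀ F t₀ (Icc t₀ T) R Ω →
    trackingError (R₀ t₀) (Ω₀ t₀) (R t₀) (Ω t₀) < δ →
    trackingError (R₀ T) (Ω₀ T) (R T) (Ω T)
      ≤ C * Real.exp (-c * (T - t₀)) * trackingError (R₀ t₀) (Ω₀ t₀) (R t₀) (Ω t₀)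

/-- A quadratic Lyapunov function for the linearized error dynamics `x' = y` yields the exponential
estimate for the full dynamics `x' = y + q` with a quadratic remainder `q`. -/
theorem hasExponentialEstimate_of_lyapunov {n : Type*} [Fintype n] {R₀ : ℝ → Mat3}
    {Ω₀ u₀ : ℝ → Vec3} (href : IsReference R₀ Ω₀ u₀) {F : FeedbackLaw} {P : Matrix n n ℝ}
    (hPs : Pᵀ = P) {a b m η κ : ℝ} (ha : 0 < a) (hb : 0 < b) (hm : 0 < m) (hη : 0 < η)
    (hκ : 0 < κ) (hP : ∀ x, a * (x ⬝ᵥ x) ≤ x ⬝ᵥ P *ᵥ x)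
    (hx : ∀ t₀ T : ℝ, 0 ≤ t₀ → t₀ ≤ T → ∀ (R : ℝ → Mat3) (Ω : ℝ → Vec3),
      IsClosedLoop u₀ F t₀ (Icc t₀ T) R Ω → ∃ x y q : ℝ → n → ℝ,
        x t₀ ⬝ᵥ x t₀ ≤ b * (‖Zk R₀ R t₀‖₂ ^ 2 + ‖Ω t₀ - Ω₀ t₀‖₂ ^ 2) ∧
        ∀ t ∈ Icc t₀ T, HasDerivWithinAt x (y t + q t) (Icc t₀ T) t ∧
          2 * (x t ⬝ᵥ P *ᵥ y t) ≤ -η * (x t ⬝ᵥ x t) ∧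
          ‖q t‖₂ ≤ κ * (‖R t - R₀ t‖ * ‖Ω t - Ω₀ t‖₂) ∧
          m * (‖Zk R₀ R t‖₂ ^ 2 + ‖Ω t - Ω₀ t‖₂ ^ 2) ≤ x t ⬝ᵥ x t) :
    HasExponentialEstimate R₀ Ω₀ u₀ F := by
  set p := ‖P‖ + 1 with hp
  have hp0 : 0 < p := by positivity
  set r := min 1 (η * √m / (4 * p * κ)) with hr
  have hr0 : 0 < r := by positivity
  have hr1 : r ≤ 1 := min_le_left _ _
  have hr2 : 4 * p * κ * r ≤ η * √m := by
    have h1 : r ≤ η * √m / (4 * p * κ) := min_le_right _ _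
    rwa [le_div_iff₀ (by positivity), mul_comm] at h1
  set a' := a * m / 9 with ha'
  set b' := p * b with hb'
  have ha0 : 0 < a' := by positivity
  have hb0 : 0 < b' := by positivity
  set s := min 1 (a' / b') with hs
  have hs0 : 0 < s := by positivity
  have hs1 : s ≤ 1 := min_le_left _ _
  have hs2 : b' * s ≤ a' := by
    have h1 : s ≤ a' / b' := min_le_right _ _
    rwa [le_div_iff₀ hb0, mul_comm] at h1
  set c := η / (2 * p) with hc
  have hc0 : 0 < c := by positivity
  refine ⟨r * s, by positivity, √(b' / a'), by positivity, c / 2, by positivity, ?_⟩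
  intro t₀ ht₀ T hT R Ω hcl hδ
  obtain ⟨x, y, q, hinit, hxt⟩ := hx t₀ T ht₀ hT R Ω hcl
  have h₀ := href.isTrajectory_Icc (T := T) ht₀
  set e : ℝ → ℝ := fun t => trackingError (R₀ t) (Ω₀ t) (R t) (Ω t) with he
  have he0 : ∀ t, 0 ≤ e t := fun t => trackingError_nonneg _ _ _ _
  have hesq : ∀ t, e t ^ 2 = ‖R t - R₀ t‖ ^ 2 + ‖Ω t - Ω₀ t‖₂ ^ 2 := fun t =>
    trackingError_sq _ _ _ _
  have hVub : ∀ v : n → ℝ, v ⬝ᵥ P *ᵥ v ≤ p * (v ⬝ᵥ v) := by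
    intro v
    rw [dotProduct_self_eq_norm_sq]
    have h1 := (le_abs_self _).trans (abs_dotProduct_le v (P *ᵥ v))
    have h2 := norm_toLp_mulVec_le P v
    have h3 := mul_le_mul_of_nonneg_left h2 (norm_nonneg (WithLp.toLp 2 v))
    have h4 := sq_nonneg ‖v‖₂
    rw [hp]
    linarith
  have hdecay := sq_le_exp_mul_of_lyapunov (V := fun t => x t ⬝ᵥ P *ᵥ x t)
    (V' := fun t => 2 * (x t ⬝ᵥ P *ᵥ (y t + q t))) (e := e) (a := a') (b := b') (c := c)
    (r := r) hT ha0 hc0.le hr0 hb0.le (continuousOn_trackingError h₀ hcl)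
    (hδ.trans_le (mul_le_of_le_one_right hr0.le hs1)) ?_ ?_ ?_ ?_
  · have h1 : e T ^ 2 ≤ (√(b' / a') * Real.exp (-(c / 2) * (T - t₀)) * e t₀) ^ 2 := by
      rw [mul_pow, mul_pow, Real.sq_sqrt (by positivity), ← Real.exp_nat_mul]
      have h2 : ((2 : ℕ) : ℝ) * (-(c / 2) * (T - t₀)) = -c * (T - t₀) := by
        push_cast
        ring
      rw [h2, div_mul_eq_mul_div, div_mul_eq_mul_div, le_div_iff₀ ha0, mul_comm]
      exact hdecay
    exact (sq_le_sq₀ (he0 T) (mul_nonneg (by positivity) (he0 t₀))).1 h1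
  · intro t ht
    have h1 := (hxt t ht).1
    refine (h1.dotProduct (h1.const_mulVec P)).congr_deriv ?_
    have h2 : (y t + q t) ⬝ᵥ P *ᵥ x t = x t ⬝ᵥ P *ᵥ (y t + q t) := by
      rw [Matrix.dotProduct_mulVec, ← Matrix.mulVec_transpose, hPs, dotProduct_comm]
    rw [h2]
    ring
  · intro t ht het
    obtain ⟨-, hy, hq, hzm⟩ := hxt t ht
    have hRe : ‖R t - R₀ t‖ ≤ r := (norm_sub_le_trackingError _ _ _ _).trans het
    have hz : ‖R t - R₀ t‖ ≤ 3 * ‖Zk R₀ R t‖₂ := by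
      rw [← norm_transpose_mul_sub_one (h₀.mem_SO3 t ht), Zk_eq]
      refine norm_sub_one_le ?_ ?_
      · rw [Matrix.transpose_mul, Matrix.transpose_transpose, Matrix.mul_assoc,
          ← Matrix.mul_assoc (R t), SO3.mul_transpose (hcl.mem_SO3 t ht), Matrix.one_mul,
          SO3.transpose_mul (h₀.mem_SO3 t ht)]
      · rw [norm_transpose_mul_sub_one (h₀.mem_SO3 t ht)]
        exact hRe.trans hr1
    have hlow : a' * e t ^ 2 ≤ x t ⬝ᵥ P *ᵥ x t := by
      refine le_trans ?_ (hP (x t))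
      have h1 : e t ^ 2 ≤ 9 * (‖Zk R₀ R t‖₂ ^ 2 + ‖Ω t - Ω₀ t‖₂ ^ 2) := by
        rw [hesq]
        nlinarith [norm_nonneg (R t - R₀ t), norm_nonneg (WithLp.toLp 2 (Ω t - Ω₀ t))]
      calc a' * e t ^ 2 ≤ a' * (9 * (‖Zk R₀ R t‖₂ ^ 2 + ‖Ω t - Ω₀ t‖₂ ^ 2)) := by gcongr
        _ = a * (m * (‖Zk R₀ R t‖₂ ^ 2 + ‖Ω t - Ω₀ t‖₂ ^ 2)) := by
          rw [ha']
          ring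
        _ ≤ _ := by gcongr
    refine ⟨hlow, ?_⟩
    have hΩ : √m * ‖Ω t - Ω₀ t‖₂ ≤ ‖x t‖₂ := by
      refine (sq_le_sq₀ (by positivity) (norm_nonneg _)).1 ?_
      rw [mul_pow, Real.sq_sqrt hm.le, ← dotProduct_self_eq_norm_sq (x t)]
      nlinarith [sq_nonneg ‖Zk R₀ R t‖₂]
    have hrem : 2 * (x t ⬝ᵥ P *ᵥ q t) ≤ η / 2 * (x t ⬝ᵥ x t) := by
      have h1 := (le_abs_self _).trans (abs_dotProduct_le (x t) (P *ᵥ q t))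
      have h2 : ‖P *ᵥ q t‖₂ ≤ p * (κ * (r * ‖Ω t - Ω₀ t‖₂)) := by
        refine (norm_toLp_mulVec_le P (q t)).trans ?_
        gcongr
        · rw [hp]
          linarith
        · exact hq.trans (by gcongr)
      have h3 : 4 * ‖P *ᵥ q t‖₂ ≤ η * ‖x t‖₂ := by
        calc 4 * ‖P *ᵥ q t‖₂ ≤ 4 * (p * (κ * (r * ‖Ω t - Ω₀ t‖₂))) := by gcongr
          _ = (4 * p * κ * r) * ‖Ω t - Ω₀ t‖₂ := by ring
          _ ≤ (η * √m) * ‖Ω t - Ω₀ t‖₂ := by gcongr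
          _ = η * (√m * ‖Ω t - Ω₀ t‖₂) := by ring
          _ ≤ _ := by gcongr
      rw [dotProduct_self_eq_norm_sq]
      have h5 := mul_le_mul_of_nonneg_left h3 (norm_nonneg (WithLp.toLp 2 (x t)))
      linarith
    have h4 : c * (x t ⬝ᵥ P *ᵥ x t) ≤ η / 2 * (x t ⬝ᵥ x t) := by
      calc c * (x t ⬝ᵥ P *ᵥ x t) ≤ c * (p * (x t ⬝ᵥ x t)) := by
            gcongr
            exact hVub _
        _ = _ := by
            rw [hc]
            field_simp
    rw [Matrix.mulVec_add, dotProduct_add]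
    linarith
  · refine (hVub _).trans ?_
    rw [hb', mul_assoc]
    refine mul_le_mul_of_nonneg_left (hinit.trans (mul_le_mul_of_nonneg_left ?_ hb.le)) hp0.le
    rw [hesq]
    have := norm_Zk_le (R := R) (h₀.mem_SO3 t₀ (left_mem_Icc.2 hT))
    gcongr
  · have h1 : e t₀ ^ 2 < (r * s) ^ 2 := by
      have := he0 t₀
      gcongr
    calc b' * e t₀ ^ 2 < b' * (r * s) ^ 2 := by gcongr
      _ = (b' * s) * s * r ^ 2 := by ring
      _ ≤ a' * 1 * r ^ 2 := by gcongr
      _ = a' * r ^ 2 := by ring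

theorem norm_le_norm_toLp {n : Type*} [Fintype n] (v : n → ℝ) : ‖v‖ ≤ ‖v‖₂ :=
  (pi_norm_le_iff_of_nonneg (norm_nonneg _)).2 fun i => PiLp.norm_apply_le (WithLp.toLp 2 v) i

theorem norm_toLp_le (v : Vec3) : ‖v‖₂ ≤ 2 * ‖v‖ := by
  refine (sq_le_sq₀ (norm_nonneg _) (by positivity)).1 ?_
  rw [norm_sq_fin_three]
  have h : ∀ i, v i ^ 2 ≤ ‖v‖ ^ 2 := fun i => by
    rw [← sq_abs (v i), ← Real.norm_eq_abs]
    have := norm_le_pi_norm v i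
    gcongr
  nlinarith [h 0, h 1, h 2, sq_nonneg ‖v‖]

theorem norm_mulVec_le (M : Mat3) (v : Vec3) : ‖M *ᵥ v‖ ≤ 2 * ‖M‖ * ‖v‖ :=
  calc ‖M *ᵥ v‖ ≤ ‖M *ᵥ v‖₂ := norm_le_norm_toLp _
    _ ≤ ‖M‖ * ‖v‖₂ := norm_toLp_mulVec_le _ _
    _ ≤ ‖M‖ * (2 * ‖v‖) := by gcongr; exact norm_toLp_le v
    _ = _ := by ring

theorem norm_veeSkew_le' (A : Mat3) : ‖veeSkew A‖ ≤ ‖A‖ :=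
  (norm_le_norm_toLp _).trans (norm_veeSkew_le A)

theorem norm_of_mem_SO3 {R : Mat3} (hR : Rᵀ * R = 1) : ‖R‖ ≤ 2 := by
  refine (sq_le_sq₀ (norm_nonneg _) (by norm_num)).1 ?_
  rw [frobenius_norm_sq, hR]
  simp
  norm_num

theorem hat_smul (c : ℝ) (v : Vec3) : hat (c • v) = c • hat v := by
  ext i j
  fin_cases i <;> fin_cases j <;> simp [hat]

theorem hat_add (v w : Vec3) : hat (v + w) = hat v + hat w := by
  ext i j
  fin_cases i <;> fin_cases j <;> simp [hat] <;> ring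

/-- The hat map as a continuous linear map. -/
noncomputable def hatCLM : Vec3 →L[ℝ] Mat3 := LinearMap.toContinuousLinearMap
  { toFun := hat
    map_add' := hat_add
    map_smul' := hat_smul }

theorem hatCLM_apply (v : Vec3) : hatCLM v = hat v := rfl

/-- A cutoff of the kinematic vector field that is globally Lipschitz, and still of the
form `R Ŵ`. -/
theorem exists_lipschitzWith_cutoff (M : ℝ) : ∃ (L : NNReal) (W : Mat3 × Vec3 → Vec3),
    Continuous W ∧ (∀ p : Mat3 × Vec3, ‖p‖ ≤ M → W p = p.2) ∧
      LipschitzWith L fun p : Mat3 × Vec3 => p.1 * hat (W p) := by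
  let χ : ContDiffBump (0 : Mat3 × Vec3) := ⟨max M 1, max M 1 + 1, by positivity, by linarith⟩
  have hg : ContDiff ℝ 1 fun p : Mat3 × Vec3 => χ p • (p.1 * hat p.2) :=
    χ.contDiff.smul (contDiff_fst.mul (hatCLM.contDiff.comp contDiff_snd))
  have hs : HasCompactSupport fun p : Mat3 × Vec3 => χ p • (p.1 * hat p.2) :=
    χ.hasCompactSupport.smul_right
  obtain ⟨L, hL⟩ := hg.lipschitzWith_of_hasCompactSupport hs one_ne_zero
  refine ⟨L, fun p => χ p • p.2, χ.continuous.smul continuous_snd, fun p hp => ?_, ?_⟩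
  · change χ p • p.2 = p.2
    rw [χ.one_of_mem_closedBall, one_smul]
    rw [mem_closedBall_zero_iff]
    exact hp.trans (le_max_left _ _)
  · simpa only [hat_smul, Matrix.mul_smul] using hL

/-- Solutions of the closed loop with a cutoff in the kinematic equation exist globally. -/
theorem exists_cutoff_solution {R₀ A B : ℝ → Mat3} {Ω₀ u₀ : ℝ → Vec3} (K : Mat3) {m : ℝ}
    (hR₀c : Continuous R₀) (hΩ₀c : Continuous Ω₀) (hu₀c : Continuous u₀) (hAc : Continuous A)
    (hBc : Continuous B) (hR₀ : ∀ t, R₀ t ∈ SO3) (hΩ₀ : ∀ t, ‖Ω₀ t‖ ≤ m) (hu₀ : ∀ t, ‖u₀ t‖ ≤ m)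
    (hA : ∀ t, ‖A t‖ ≤ m) (hB : ∀ t, ‖B t‖ ≤ m) (M t₀ : ℝ) (R₁ : Mat3) (Ω₁ : Vec3) :
    ∃ (R : ℝ → Mat3) (Ω W ζ : ℝ → Vec3), R t₀ = R₁ ∧ Ω t₀ = Ω₁ ∧ ζ t₀ = 0 ∧
      ContinuousOn W (Ici t₀) ∧ (∀ t, ‖R t‖ ≤ M → ‖Ω t‖ ≤ M → W t = Ω t) ∧
      ∀ t, t₀ ≤ t → HasDerivAt R (R t * hat (W t)) t ∧
        HasDerivAt Ω (u₀ t + (A t *ᵥ veeSkew ((R₀ t)ᵀ * R t) + B t *ᵥ (Ω t - Ω₀ t) + K *ᵥ ζ t)) t ∧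
        HasDerivAt ζ (veeSkew ((R₀ t)ᵀ * R t)) t := by
  have hm : 0 ≤ m := (norm_nonneg _).trans (hA 0)
  obtain ⟨L, W, hWc, hW, hL⟩ := exists_lipschitzWith_cutoff M
  let f : ℝ → Mat3 × Vec3 × Vec3 → Mat3 × Vec3 × Vec3 := fun t y =>
    (y.1 * hat (W (y.1, y.2.1)),
      u₀ t + (A t *ᵥ veeSkew ((R₀ t)ᵀ * y.1) + B t *ᵥ (y.2.1 - Ω₀ t) + K *ᵥ y.2.2),
      veeSkew ((R₀ t)ᵀ * y.1))
  have hhat : Continuous hat := hatCLM.continuous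
  have hvs : Continuous veeSkew := veeSkew.continuous
  have hfc : Continuous (Function.uncurry f) := by
    refine Continuous.prodMk ?_ (Continuous.prodMk ?_ ?_) <;> fun_prop
  have hz : ∀ t (X Y : Mat3), ‖veeSkew ((R₀ t)ᵀ * X) - veeSkew ((R₀ t)ᵀ * Y)‖ ≤ ‖X - Y‖ := by
    intro t X Y
    rw [← map_sub, ← Matrix.mul_sub, ← norm_transpose_mul_of_mem_SO3 (hR₀ t) (X - Y)]
    exact norm_veeSkew_le' _
  have hfL : ∀ t, LipschitzWith (L + (Real.toNNReal (4 * m + 2 * ‖K‖) + 1)) (f t) := by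
    intro t
    refine LipschitzWith.of_dist_le_mul fun x y => ?_
    rw [dist_eq_norm, dist_eq_norm, NNReal.coe_add, NNReal.coe_add,
      Real.coe_toNNReal _ (by positivity), NNReal.coe_one]
    have hx1 : ‖x.1 - y.1‖ ≤ ‖x - y‖ := norm_fst_le (x - y)
    have hx2 : ‖x.2.1 - y.2.1‖ ≤ ‖x - y‖ :=
      (norm_fst_le (x - y).2).trans (norm_snd_le (x - y))
    have hx3 : ‖x.2.2 - y.2.2‖ ≤ ‖x - y‖ :=
      (norm_snd_le (x - y).2).trans (norm_snd_le (x - y))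
    have hd := norm_nonneg (x - y)
    refine norm_prod_le_iff.2 ⟨?_, norm_prod_le_iff.2 ⟨?_, ?_⟩⟩
    · have h1 := hL.norm_sub_le (x.1, x.2.1) (y.1, y.2.1)
      have h2 : ‖((x.1, x.2.1) : Mat3 × Vec3) - (y.1, y.2.1)‖ ≤ ‖x - y‖ :=
        norm_prod_le_iff.2 ⟨hx1, hx2⟩
      calc ‖(f t x - f t y).1‖ ≤ L * ‖x - y‖ := h1.trans (by gcongr)
        _ ≤ (L + (4 * m + 2 * ‖K‖ + 1)) * ‖x - y‖ := by
          gcongr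
          have := norm_nonneg K
          linarith
    · have h1 : (f t x - f t y).2.1
          = A t *ᵥ (veeSkew ((R₀ t)ᵀ * x.1) - veeSkew ((R₀ t)ᵀ * y.1))
            + B t *ᵥ (x.2.1 - y.2.1) + K *ᵥ (x.2.2 - y.2.2) := by
        simp only [f, Prod.fst_sub, Prod.snd_sub, Matrix.mulVec_sub]
        abel
      rw [h1]
      calc _ ≤ 2 * m * ‖x - y‖ + 2 * m * ‖x - y‖ + 2 * ‖K‖ * ‖x - y‖ := by
            refine (norm_add₃_le).trans ?_
            gcongr
            · exact (norm_mulVec_le _ _).trans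
                (by gcongr; exacts [hA t, (hz t _ _).trans hx1])
            · exact (norm_mulVec_le _ _).trans (by gcongr; exact hB t)
            · exact (norm_mulVec_le _ _).trans (by gcongr)
        _ = (0 + (4 * m + 2 * ‖K‖ + 0)) * ‖x - y‖ := by ring
        _ ≤ _ := by gcongr <;> positivity
    · calc ‖(f t x - f t y).2.2‖ ≤ ‖x - y‖ := (hz t _ _).trans hx1
        _ = (0 + (0 + 1)) * ‖x - y‖ := by ring
        _ ≤ _ := by gcongr <;> positivity
  have hf0 : ∀ t, ‖f t 0‖ ≤ m + 2 * m * m := by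
    intro t
    have h1 : f t 0 = (0, u₀ t + B t *ᵥ (0 - Ω₀ t), 0) := by
      simp only [f, Prod.fst_zero, Prod.snd_zero, zero_mul, mul_zero, map_zero, Matrix.mulVec_zero,
        zero_add, add_zero]
    rw [h1]
    refine norm_prod_le_iff.2 ⟨?_, norm_prod_le_iff.2 ⟨?_, ?_⟩⟩
    · simpa using by positivity
    · refine (norm_add_le _ _).trans (add_le_add (hu₀ t) ((norm_mulVec_le _ _).trans ?_))
      rw [zero_sub, norm_neg]
      gcongr
      exacts [hB t, hΩ₀ t]
    · simpa using by positivity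
  obtain ⟨y, hy0, hy⟩ := exists_hasDerivAt_of_lipschitzWith hfc hfL hf0 t₀ (R₁, Ω₁, 0)
  have hyc : ContinuousOn y (Ici t₀) := fun t ht => (hy t ht).continuousAt.continuousWithinAt
  refine ⟨fun t => (y t).1, fun t => (y t).2.1, fun t => W ((y t).1, (y t).2.1),
    fun t => (y t).2.2, by simp [hy0], by simp [hy0], by simp [hy0], ?_, ?_, fun t ht => ?_⟩
  · exact hWc.comp_continuousOn (hyc.fst.prodMk hyc.snd.fst)
  · intro t h1 h2
    exact hW _ (norm_prod_le_iff.2 ⟨h1, h2⟩)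
  · have h := hy t ht
    exact ⟨h.fst, h.snd.fst, h.snd.snd⟩

/-- Solutions of the kinematic equation stay in `SO(3)`. -/
theorem mem_SO3_of_hasDerivAt {R : ℝ → Mat3} {W : ℝ → Vec3} {t₀ : ℝ} (h₀ : R t₀ ∈ SO3)
    (hW : ContinuousOn W (Ici t₀)) (hR : ∀ t, t₀ ≤ t → HasDerivAt R (R t * hat (W t)) t) :
    ∀ t, t₀ ≤ t → R t ∈ SO3 := by
  have hRc : ContinuousOn R (Ici t₀) := fun t ht => (hR t ht).continuousAt.continuousWithinAt
  have horth : ∀ t, t₀ ≤ t → (R t)ᵀ * R t = 1 := by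
    intro T hT
    obtain ⟨k, hk⟩ := isCompact_Icc.exists_bound_of_continuousOn
      (hatCLM.continuous.comp_continuousOn (hW.mono (Icc_subset_Ici_self : Icc t₀ T ⊆ Ici t₀)))
    have hd : ∀ t, t₀ ≤ t → HasDerivAt (fun t => (R t)ᵀ * R t - 1)
        (((R t)ᵀ * R t - 1) * hat (W t) - hat (W t) * ((R t)ᵀ * R t - 1)) t := by
      intro t ht
      have h1 := (((hR t ht).hasDerivWithinAt (s := univ)).matrix_transpose.mul
        ((hR t ht).hasDerivWithinAt (s := univ))).sub_const (1 : Mat3)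
      rw [hasDerivWithinAt_univ] at h1
      refine h1.congr_deriv ?_
      rw [Matrix.transpose_mul, transpose_hat]
      noncomm_ring
    have h1 := norm_le_gronwallBound_of_norm_deriv_right_le (δ := 0) (K := 2 * k) (ε := 0)
      (fun t ht => (hd t ht.1).continuousAt.continuousWithinAt)
      (fun t ht => (hd t ht.1).hasDerivWithinAt)
      (by simp [SO3.transpose_mul h₀]) (fun t ht => ?_) T (right_mem_Icc.2 hT)
    · rw [gronwallBound_ε0_δ0] at h1
      exact sub_eq_zero.1 (norm_le_zero_iff.1 h1)
    · have h2 := hk t ⟨ht.1, ht.2.le⟩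
      simp only [Function.comp_apply, hatCLM_apply] at h2
      set Q := (R t)ᵀ * R t - 1
      calc ‖Q * hat (W t) - hat (W t) * Q‖ ≤ ‖Q‖ * ‖hat (W t)‖ + ‖hat (W t)‖ * ‖Q‖ :=
            (norm_sub_le _ _).trans (add_le_add (norm_mul_le _ _) (norm_mul_le _ _))
        _ ≤ ‖Q‖ * k + k * ‖Q‖ := by gcongr
        _ = _ := by ring
  intro t ht
  refine (mem_SO3_iff _).2 ⟨horth t ht, ?_⟩
  by_contra! hneg
  have hdetc : ContinuousOn (fun t => (R t).det) (Icc t₀ t) := by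
    have : Continuous fun X : Mat3 => X.det := Continuous.matrix_det continuous_id
    exact this.comp_continuousOn (hRc.mono Icc_subset_Ici_self)
  obtain ⟨s, hs, hs0⟩ := intermediate_value_Icc' ht hdetc ⟨hneg, ((mem_SO3_iff _).1 h₀).2.le⟩
  have h1 := congrArg Matrix.det (horth s hs.1)
  rw [Matrix.det_mul, Matrix.det_one] at h1
  simp only at hs0
  rw [hs0, mul_zero] at h1
  exact zero_ne_one h1

/-- A gain signal that is continuous and bounded on `[0, ∞)`. -/
def IsAdmissibleGain (A : ℝ → Mat3) : Prop :=
  ContinuousOn A (Ici 0) ∧ ∃ m : ℝ, ∀ t, 0 ≤ t → ‖A t‖ ≤ m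

namespace IsAdmissibleGain

variable {A B : ℝ → Mat3}

theorem const (K : Mat3) : IsAdmissibleGain fun _ => K :=
  ⟨continuousOn_const, ‖K‖, fun _ _ => le_rfl⟩

theorem add (hA : IsAdmissibleGain A) (hB : IsAdmissibleGain B) :
    IsAdmissibleGain fun t => A t + B t := by
  obtain ⟨hAc, a, ha⟩ := hA
  obtain ⟨hBc, b, hb⟩ := hB
  exact ⟨hAc.add hBc, a + b, fun t ht => (norm_add_le _ _).trans (add_le_add (ha t ht) (hb t ht))⟩

theorem mul (hA : IsAdmissibleGain A) (hB : IsAdmissibleGain B) :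
    IsAdmissibleGain fun t => A t * B t := by
  obtain ⟨hAc, a, ha⟩ := hA
  obtain ⟨hBc, b, hb⟩ := hB
  have ha0 := (norm_nonneg _).trans (ha 0 le_rfl)
  exact ⟨hAc.mul hBc, a * b, fun t ht => (norm_mul_le _ _).trans
    (mul_le_mul (ha t ht) (hb t ht) (norm_nonneg _) ha0)⟩

theorem sub (hA : IsAdmissibleGain A) (hB : IsAdmissibleGain B) :
    IsAdmissibleGain fun t => A t - B t := by
  obtain ⟨hAc, a, ha⟩ := hA
  obtain ⟨hBc, b, hb⟩ := hB
  exact ⟨hAc.sub hBc, a + b, fun t ht => (norm_sub_le _ _).trans (add_le_add (ha t ht) (hb t ht))⟩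

theorem hat {v : ℝ → Vec3} (hv : ContinuousOn v (Ici 0))
    (hb : ∃ M : ℝ, ∀ t, 0 ≤ t → ‖v t‖₂ ≤ M) : IsAdmissibleGain fun t => hat (v t) := by
  obtain ⟨m, hm⟩ := hb
  exact ⟨hatCLM.continuous.comp_continuousOn hv, 2 * m, fun t ht =>
    (norm_hat_le _).trans (by linarith [hm t ht])⟩

end IsAdmissibleGain

/-- For a feedback law that is affine in the attitude error, the velocity error and the integrated
attitude error, the exponential estimate implies exponential tracking. -/
theorem HasExponentialEstimate.exponentiallyTracks {R₀ : ℝ → Mat3} {Ω₀ u₀ : ℝ → Vec3}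
    (href : IsReference R₀ Ω₀ u₀) {F : FeedbackLaw} {A B : ℝ → Mat3} {K : Mat3}
    (hA : IsAdmissibleGain A) (hB : IsAdmissibleGain B)
    (hF : ∀ t₀ R Ω t, F t₀ R Ω t = A t *ᵥ Zk R₀ R t + B t *ᵥ (Ω t - Ω₀ t)
      + K *ᵥ ∫ s in t₀..t, Zk R₀ R s)
    (hest : HasExponentialEstimate R₀ Ω₀ u₀ F) : ExponentiallyTracks R₀ Ω₀ u₀ F := by
  obtain ⟨hAc, a, hA⟩ := hA
  obtain ⟨hBc, b, hB⟩ := hB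
  obtain ⟨δ, hδ, C, hC, c, hc, hest⟩ := hest
  refine ⟨δ, hδ, C, hC, c, hc, fun t₀ ht₀ => ⟨fun R₁ hR₁ Ω₁ he₁ => ?_, ?_⟩⟩
  swap
  · intro J hJ hleast R Ω hcl he t ht
    exact hest t₀ ht₀ t (hleast.2 ht) R Ω (hcl.mono (hJ.out hleast.1 ht)) he
  have href0 := href.isTrajectory
  obtain ⟨m₁, hm₁⟩ := href.bounded_Ω₀
  obtain ⟨m₂, hm₂⟩ := href.bounded_u₀
  set r := C * δ + δ with hr
  have hp : Continuous fun t : ℝ => max t 0 := by fun_prop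
  have hp0 : ∀ t : ℝ, 0 ≤ max t 0 := fun t => le_max_right _ _
  have hext : ∀ {X : Type} [TopologicalSpace X] {g : ℝ → X}, ContinuousOn g (Ici 0) →
      Continuous fun t => g (max t 0) := fun hg => hg.comp_continuous hp hp0
  obtain ⟨R, Ω, W, ζ, hR1, hΩ1, hζ1, hWc, hW, hd⟩ := exists_cutoff_solution K
    (hext href0.continuousOn_R) (hext href0.continuousOn_Ω) (hext href.continuousOn_u₀)
    (hext hAc) (hext hBc) (fun t => href0.mem_SO3 _ (hp0 t)) (m := max (max a b) (max m₁ m₂))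
    (fun t => (norm_le_norm_toLp _).trans ((hm₁ _ (hp0 t)).trans
      ((le_max_left _ _).trans (le_max_right _ _))))
    (fun t => (norm_le_norm_toLp _).trans ((hm₂ _ (hp0 t)).trans
      ((le_max_right _ _).trans (le_max_right _ _))))
    (fun t => (hA _ (hp0 t)).trans ((le_max_left _ _).trans (le_max_left _ _)))
    (fun t => (hB _ (hp0 t)).trans ((le_max_right _ _).trans (le_max_left _ _)))
    (max 2 (m₁ + r)) t₀ R₁ Ω₁
  have hSO := mem_SO3_of_hasDerivAt (hR1 ▸ hR₁) hWc fun t ht => (hd t ht).1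
  have hζ : ∀ t, t₀ ≤ t → ζ t = ∫ s in t₀..t, Zk R₀ R s := by
    intro t ht
    have hpos : ∀ s ∈ uIcc t₀ t, t₀ ≤ s := fun s hs => by
      rw [uIcc_of_le ht] at hs
      exact hs.1
    have h1 : ∀ s ∈ uIcc t₀ t, HasDerivAt ζ (Zk R₀ R s) s := by
      intro s hs
      have h2 := (hd s (hpos s hs)).2.2
      rwa [max_eq_left (ht₀.trans (hpos s hs))] at h2
    have hcont : ContinuousOn (Zk R₀ R) (uIcc t₀ t) := by
      refine veeSkew.continuous.comp_continuousOn (ContinuousOn.mul ?_ ?_)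
      · exact (continuous_id.matrix_transpose).comp_continuousOn
          (href0.continuousOn_R.mono fun s hs => ht₀.trans (hpos s hs))
      · exact fun s hs => (hd s (hpos s hs)).1.continuousAt.continuousWithinAt
    rw [intervalIntegral.integral_eq_sub_of_hasDerivAt h1 hcont.intervalIntegrable, hζ1, sub_zero]
  have hclosed : ∀ J ⊆ Ici t₀, (∀ t ∈ J, trackingError (R₀ t) (Ω₀ t) (R t) (Ω t) ≤ r) →
      IsClosedLoop u₀ F t₀ J R Ω := by
    intro J hJ hle
    refine ⟨fun t ht => hSO t (hJ ht), fun t ht => ?_, fun t ht => ?_⟩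
    · have ht' : t₀ ≤ t := hJ ht
      rw [← hW t]
      · exact (hd t ht').1.hasDerivWithinAt
      · exact (norm_of_mem_SO3 (SO3.transpose_mul (hSO t ht'))).trans (le_max_left _ _)
      · refine (norm_le_norm_toLp _).trans (le_trans ?_ (le_max_right _ _))
        have h1 : ‖Ω t‖₂ ≤ ‖Ω₀ t‖₂ + ‖Ω t - Ω₀ t‖₂ := by
          have := norm_add_le (WithLp.toLp 2 (Ω₀ t)) (WithLp.toLp 2 (Ω t - Ω₀ t))
          rwa [← WithLp.toLp_add, add_sub_cancel] at this
        have h2 := hm₁ t (ht₀.trans ht')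
        have h3 := (norm_sub_le_trackingError' (R₀ t) (Ω₀ t) (R t) (Ω t)).trans (hle t ht)
        linarith
    · have ht' : t₀ ≤ t := hJ ht
      have h1 := (hd t ht').2.1
      rw [max_eq_left (ht₀.trans ht'), hζ t ht'] at h1
      refine h1.hasDerivWithinAt.congr_deriv ?_
      rw [hF, Zk_eq]
  have hRc : ContinuousOn R (Ici t₀) := fun t ht => (hd t ht).1.continuousAt.continuousWithinAt
  have hΩc : ContinuousOn Ω (Ici t₀) := fun t ht => (hd t ht).2.1.continuousAt.continuousWithinAt
  have hinit : trackingError (R₀ t₀) (Ω₀ t₀) (R t₀) (Ω t₀) < δ := by rwa [hR1, hΩ1]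
  have hlt := forall_lt_of_first_exit (g := fun t => trackingError (R₀ t) (Ω₀ t) (R t) (Ω t))
    (r := r) (J := Ici t₀) ordConnected_Ici isLeast_Ici ?_ ?_ ?_
  · exact ⟨R, Ω, hclosed _ Subset.rfl fun t ht => (hlt t ht).le, hR1, hΩ1⟩
  · refine ContinuousOn.sqrt (ContinuousOn.add (ContinuousOn.pow (ContinuousOn.norm ?_) 2)
      (ContinuousOn.pow (ContinuousOn.norm ?_) 2))
    · exact hRc.sub (href0.continuousOn_R.mono fun s hs => ht₀.trans hs)
    · exact (PiLp.continuous_toLp 2 (fun _ : Fin 3 => ℝ)).comp_continuousOn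
        (hΩc.sub (href0.continuousOn_Ω.mono fun s hs => ht₀.trans hs))
  · refine hinit.trans_le ?_
    rw [hr]
    nlinarith
  · intro t ht hle
    have h1 := hest t₀ ht₀ t ht R Ω (hclosed _ Icc_subset_Ici_self hle) hinit
    have h2 : Real.exp (-c * (t - t₀)) ≤ 1 := by
      rw [Real.exp_le_one_iff]
      nlinarith [mem_Ici.1 ht]
    have h3 := trackingError_nonneg (R₀ t₀) (Ω₀ t₀) (R t₀) (Ω t₀)
    calc _ ≤ C * Real.exp (-c * (t - t₀)) * trackingError (R₀ t₀) (Ω₀ t₀) (R t₀) (Ω t₀) := h1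
      _ ≤ C * 1 * δ := by gcongr
      _ < r := by
        rw [hr]
        linarith

end RigidBody

theorem HasDerivWithinAt.sumElim {m n : Type*} [Fintype m] [Fintype n] {x : ℝ → m → ℝ}
    {y : ℝ → n → ℝ} {x' : m → ℝ} {y' : n → ℝ} {J : Set ℝ} {t : ℝ}
    (hx : HasDerivWithinAt x x' J t) (hy : HasDerivWithinAt y y' J t) :
    HasDerivWithinAt (fun t => Sum.elim (x t) (y t)) (Sum.elim x' y') J t := by
  rw [hasDerivWithinAt_pi] at hx hy ⊢
  rintro (i | i)
  exacts [hx i, hy i]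

theorem norm_sq_sumElim {m n : Type*} [Fintype m] [Fintype n] (x : m → ℝ) (y : n → ℝ) :
    ‖Sum.elim x y‖₂ ^ 2 = ‖x‖₂ ^ 2 + ‖y‖₂ ^ 2 := by
  simp only [← dotProduct_self_eq_norm_sq, sumElim_dotProduct_sumElim]

theorem norm_sumElim_le {m n : Type*} [Fintype m] [Fintype n] (x : m → ℝ) (y : n → ℝ) :
    ‖Sum.elim x y‖₂ ≤ ‖x‖₂ + ‖y‖₂ := by
  refine (sq_le_sq₀ (norm_nonneg _) (by positivity)).1 ?_
  rw [norm_sq_sumElim]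
  nlinarith [norm_nonneg (WithLp.toLp 2 x), norm_nonneg (WithLp.toLp 2 y)]

/-- A strict discriminant inequality makes a binary quadratic form uniformly definite. -/
theorem exists_mul_add_le_of_discrim {α β γ : ℝ} (hα : 0 < α) (hγ : 0 < γ) (h : β ^ 2 < α * γ) :
    ∃ η : ℝ, 0 < η ∧ ∀ p s : ℝ, η * (p ^ 2 + s ^ 2) ≤ α * p ^ 2 - 2 * β * (p * s) + γ * s ^ 2 := by
  set η := (α * γ - β ^ 2) / (α + γ) with hη
  have hsum : η * (α + γ) = α * γ - β ^ 2 := by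
    rw [hη]
    field_simp
  have hη0 : 0 < η := div_pos (by linarith) (by linarith)
  have hαη : 0 < α - η := by
    have h1 : η * (α + γ) < α * (α + γ) := by
      rw [hsum]
      nlinarith [sq_nonneg β, sq_pos_of_pos hα]
    linarith [lt_of_mul_lt_mul_right h1 (by linarith)]
  refine ⟨η, hη0, fun p s => ?_⟩
  have h1 : 0 ≤ (α - η) * ((α - η) * p ^ 2 - 2 * β * (p * s) + (γ - η) * s ^ 2) := by
    have h2 : (α - η) * (γ - η) = β ^ 2 + η ^ 2 := by linarith
    have h3 : (α - η) * ((α - η) * p ^ 2 - 2 * β * (p * s) + (γ - η) * s ^ 2)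
        = ((α - η) * p - β * s) ^ 2 + ((α - η) * (γ - η) - β ^ 2) * s ^ 2 := by ring
    rw [h3, h2]
    nlinarith [sq_nonneg ((α - η) * p - β * s), sq_nonneg (η * s)]
  have h2 := nonneg_of_mul_nonneg_right h1 hαη
  linarith

theorem hasDerivWithinAt_integral_Icc {E : Type*} [NormedAddCommGroup E] [NormedSpace ℝ E]
    [CompleteSpace E] {f : ℝ → E} {a b t : ℝ} (hf : ContinuousOn f (Icc a b)) (ht : t ∈ Icc a b) :
    HasDerivWithinAt (fun u => ∫ s in a..u, f s) (f t) (Icc a b) t := by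
  have : Fact (t ∈ Icc a b) := ⟨ht⟩
  have hsub : uIcc a t ⊆ Icc a b := uIcc_subset_Icc (left_mem_Icc.2 (ht.1.trans ht.2)) ht
  exact intervalIntegral.integral_hasDerivWithinAt_right (hf.mono hsub).intervalIntegrable
    (hf.stronglyMeasurableAtFilter_nhdsWithin measurableSet_Icc t) (hf t ht)

namespace RigidBody

section ErrorDynamics

variable {R₀ R : ℝ → Mat3} {Ω₀ Ω u₀ : ℝ → Vec3} {F : FeedbackLaw} {J : Set ℝ} {t₀ t : ℝ}

/-- The quadratic remainder in the attitude error equation. -/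
noncomputable def attitudeRemainder (R₀ : ℝ → Mat3) (Ω₀ : ℝ → Vec3) (R : ℝ → Mat3) (Ω : ℝ → Vec3)
    (t : ℝ) : Vec3 :=
  veeSkew (((R₀ t)ᵀ * R t - 1) * hat (Ω t - Ω₀ t))

theorem norm_attitudeRemainder_le (h₀ : R₀ t ∈ SO3) :
    ‖attitudeRemainder R₀ Ω₀ R Ω t‖₂ ≤ 2 * (‖R t - R₀ t‖ * ‖Ω t - Ω₀ t‖₂) := by
  refine (norm_veeSkew_le _).trans ((norm_mul_le _ _).trans ?_)
  rw [norm_transpose_mul_sub_one h₀]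
  calc _ ≤ ‖R t - R₀ t‖ * (2 * ‖Ω t - Ω₀ t‖₂) := by gcongr; exact norm_hat_le _
    _ = _ := by ring

theorem IsClosedLoop.hasDerivWithinAt_Zk (h₀ : IsTrajectory J R₀ Ω₀ u₀)
    (h : IsClosedLoop u₀ F t₀ J R Ω) (ht : t ∈ J) :
    HasDerivWithinAt (Zk R₀ R)
      (linRate R₀ Ω₀ R Ω t + attitudeRemainder R₀ Ω₀ R Ω t) J t :=
  RigidBody.hasDerivWithinAt_Zk h₀ h ht

theorem IsClosedLoop.hasDerivWithinAt_sub (h₀ : IsTrajectory J R₀ Ω₀ u₀)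
    (h : IsClosedLoop u₀ F t₀ J R Ω) (ht : t ∈ J) :
    HasDerivWithinAt (fun t => Ω t - Ω₀ t) (F t₀ R Ω t) J t :=
  ((h.deriv_Ω t ht).sub (h₀.deriv_Ω t ht)).congr_deriv (by simp)

theorem IsClosedLoop.hasDerivWithinAt_linRate (h₀ : IsTrajectory J R₀ Ω₀ u₀)
    (h : IsClosedLoop u₀ F t₀ J R Ω) (ht : t ∈ J) :
    HasDerivWithinAt (linRate R₀ Ω₀ R Ω) (linRate R₀ Ω₀ R Ω t ⨯₃ Ω₀ t + Zk R₀ R t ⨯₃ u₀ t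
      + F t₀ R Ω t + attitudeRemainder R₀ Ω₀ R Ω t ⨯₃ Ω₀ t) J t := by
  have h1 := ((h.hasDerivWithinAt_Zk h₀ ht).crossProduct (h₀.deriv_Ω t ht)).add
    (h.hasDerivWithinAt_sub h₀ ht)
  refine h1.congr_deriv ?_
  rw [map_add, LinearMap.add_apply]
  abel

/-- Passing between `ΔΩ` and the linearized rate distorts the size of the error state by a bounded
factor. -/
theorem norm_sq_add_le_of_cross {z v d w : Vec3} {m : ℝ} (hw : ‖w‖₂ ≤ m)
    (hd : d = z ⨯₃ w + v) :
    ‖z‖₂ ^ 2 + ‖d‖₂ ^ 2 ≤ (2 + 2 * m ^ 2) * (‖z‖₂ ^ 2 + ‖v‖₂ ^ 2) ∧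
      ‖z‖₂ ^ 2 + ‖v‖₂ ^ 2 ≤ (2 + 2 * m ^ 2) * (‖z‖₂ ^ 2 + ‖d‖₂ ^ 2) := by
  have hc : ‖z ⨯₃ w‖₂ ≤ m * ‖z‖₂ := by
    refine (norm_cross_le z w).trans ?_
    rw [mul_comm]
    gcongr
  have key : ∀ a b : Vec3, ‖a‖₂ ≤ ‖z ⨯₃ w‖₂ + ‖b‖₂ →
      ‖z‖₂ ^ 2 + ‖a‖₂ ^ 2 ≤ (2 + 2 * m ^ 2) * (‖z‖₂ ^ 2 + ‖b‖₂ ^ 2) := by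
    intro a b h
    have h1 : ‖a‖₂ ^ 2 ≤ (m * ‖z‖₂ + ‖b‖₂) ^ 2 := by
      gcongr
      linarith
    nlinarith [sq_nonneg (m * ‖z‖₂ - ‖b‖₂), sq_nonneg ‖z‖₂, sq_nonneg (m * ‖b‖₂)]
  refine ⟨key d v ?_, key v d ?_⟩
  · rw [hd, WithLp.toLp_add]
    exact norm_add_le _ _
  · have : v = d - z ⨯₃ w := by rw [hd, add_sub_cancel_left]
    rw [this, WithLp.toLp_sub, add_comm]
    exact norm_sub_le _ _

end ErrorDynamics

/-- The exponential estimate for the PD law with feedforward. -/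
theorem lawPD_estimate {R₀ : ℝ → Mat3} {Ω₀ u₀ : ℝ → Vec3} (href : IsReference R₀ Ω₀ u₀)
    {KP KD : Mat3} (hK : IsHurwitz (Matrix.fromBlocks 0 1 (-KP) (-KD))) :
    HasExponentialEstimate R₀ Ω₀ u₀ (lawPD R₀ Ω₀ u₀ KP KD) := by
  obtain ⟨m, hm⟩ := href.bounded_Ω₀
  have hm0 : 0 ≤ m := (norm_nonneg _).trans (hm 0 le_rfl)
  obtain ⟨P, hPs, hP, η, hη, hPA⟩ := hK.exists_lyapunov
  refine hasExponentialEstimate_of_lyapunov href hPs (a := 1) (b := 2 + 2 * m ^ 2)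
    (m := (2 + 2 * m ^ 2)⁻¹) (η := η) (κ := 2 * (1 + m)) one_pos (by positivity) (by positivity) hη
    (by positivity) (by simpa using hP) fun t₀ T ht₀ hT R Ω hcl => ?_
  have h₀ := href.isTrajectory_Icc (T := T) ht₀
  have hsize : ∀ t ∈ Icc t₀ T, _ := fun t ht =>
    norm_sq_add_le_of_cross (z := Zk R₀ R t) (hm t (ht₀.trans ht.1)) (v := Ω t - Ω₀ t)
      (d := linRate R₀ Ω₀ R Ω t) rfl
  refine ⟨fun t => Sum.elim (Zk R₀ R t) (linRate R₀ Ω₀ R Ω t),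
    fun t => Matrix.fromBlocks 0 1 (-KP) (-KD) *ᵥ Sum.elim (Zk R₀ R t) (linRate R₀ Ω₀ R Ω t),
    fun t => Sum.elim (attitudeRemainder R₀ Ω₀ R Ω t) (attitudeRemainder R₀ Ω₀ R Ω t ⨯₃ Ω₀ t),
    ?_, fun t ht => ⟨?_, hPA _, ?_, ?_⟩⟩
  · simp only [dotProduct_self_eq_norm_sq, norm_sq_sumElim]
    exact (hsize t₀ (left_mem_Icc.2 hT)).1
  · refine ((hcl.hasDerivWithinAt_Zk h₀ ht).sumElim
      (hcl.hasDerivWithinAt_linRate h₀ ht)).congr_deriv ?_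
    beta_reduce
    rw [Matrix.fromBlocks_mulVec]
    simp only [Sum.elim_comp_inl, Sum.elim_comp_inr, Matrix.zero_mulVec, Matrix.one_mulVec,
      zero_add, Matrix.neg_mulVec, lawPD]
    ext (i | i) <;> simp
    ring
  · refine (norm_sumElim_le _ _).trans ?_
    have h1 := norm_attitudeRemainder_le (R := R) (Ω₀ := Ω₀) (Ω := Ω) (h₀.mem_SO3 t ht)
    have h2 : ‖attitudeRemainder R₀ Ω₀ R Ω t ⨯₃ Ω₀ t‖₂
        ≤ ‖attitudeRemainder R₀ Ω₀ R Ω t‖₂ * m :=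
      (norm_cross_le _ _).trans (by gcongr; exact hm t (ht₀.trans ht.1))
    nlinarith
  · rw [inv_mul_le_iff₀ (by positivity)]
    simp only [dotProduct_self_eq_norm_sq, norm_sq_sumElim]
    exact (hsize t ht).2

/-- The companion matrix of the error dynamics `ζ' = z`, `z' = d`,
`d' = -K_I ζ - K_P z - K_D d`. -/
def companionPID (KP KD KI : Mat3) :
    Matrix ((Fin 3 ⊕ Fin 3) ⊕ Fin 3) ((Fin 3 ⊕ Fin 3) ⊕ Fin 3) ℝ :=
  Matrix.fromBlocks (Matrix.fromBlocks 0 1 0 0) (Matrix.fromRows 0 1)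
    (Matrix.fromCols (-KI) (-KP)) (-KD)

theorem companionPID_mulVec (KP KD KI : Mat3) (ζ z d : Vec3) :
    companionPID KP KD KI *ᵥ Sum.elim (Sum.elim ζ z) d
      = Sum.elim (Sum.elim z d) (-(KI *ᵥ ζ) - KP *ᵥ z - KD *ᵥ d) := by
  rw [companionPID, Matrix.fromBlocks_mulVec]
  simp only [Sum.elim_comp_inl, Sum.elim_comp_inr, Matrix.fromBlocks_mulVec,
    Matrix.fromRows_mulVec, Matrix.fromCols_mulVec, Matrix.zero_mulVec, Matrix.one_mulVec,
    Matrix.neg_mulVec]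
  ext ((i | i) | i) <;> simp
  ring

theorem IsHurwitzPID.isHurwitz_companion {KP KD KI : Mat3} (h : IsHurwitzPID KP KD KI) :
    IsHurwitz (companionPID KP KD KI) := by
  intro z hz
  apply h
  rw [spectrum.mem_iff, Matrix.isUnit_iff_isUnit_det, isUnit_iff_ne_zero, not_not,
    ← Matrix.exists_mulVec_eq_zero_iff] at hz
  obtain ⟨v, hv0, hv⟩ := hz
  obtain ⟨a, b, c, rfl⟩ : ∃ a b c : Fin 3 → ℂ, v = Sum.elim (Sum.elim a b) c :=
    ⟨fun i => v (.inl (.inl i)), fun i => v (.inl (.inr i)), fun i => v (.inr i), by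
      ext ((i | i) | i) <;> rfl⟩
  have hmap : (companionPID KP KD KI).map Complex.ofReal
      = Matrix.fromBlocks (Matrix.fromBlocks 0 1 0 0) (Matrix.fromRows 0 1)
        (Matrix.fromCols (-KI.map Complex.ofReal) (-KP.map Complex.ofReal))
        (-KD.map Complex.ofReal) := by
    ext ((i | i) | i) ((j | j) | j) <;> simp [companionPID, Matrix.one_apply, apply_ite]
  rw [hmap, Matrix.sub_mulVec, Algebra.algebraMap_eq_smul_one, Matrix.smul_mulVec,
    Matrix.one_mulVec, Matrix.fromBlocks_mulVec, sub_eq_zero] at hv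
  simp only [Sum.elim_comp_inl, Sum.elim_comp_inr, Matrix.fromBlocks_mulVec,
    Matrix.fromRows_mulVec, Matrix.fromCols_mulVec, Matrix.zero_mulVec, Matrix.one_mulVec,
    Matrix.neg_mulVec, zero_add, add_zero] at hv
  have hab : z • a = b := by
    ext i
    simpa using congrFun hv (.inl (.inl i))
  have hbc : z • b = c := by
    ext i
    simpa using congrFun hv (.inl (.inr i))
  have hc : z • c = -(KI.map Complex.ofReal *ᵥ a) - KP.map Complex.ofReal *ᵥ b
      - KD.map Complex.ofReal *ᵥ c := by
    ext i
    have := congrFun hv (.inr i)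
    simp at this
    simp [this]
    ring
  rw [← Matrix.exists_mulVec_eq_zero_iff]
  refine ⟨a, ?_, ?_⟩
  · rintro rfl
    rw [smul_zero] at hab
    subst hab
    rw [smul_zero] at hbc
    subst hbc
    refine hv0 ?_
    ext ((i | i) | i) <;> rfl
  · subst hab
    subst hbc
    rw [Matrix.mulVec_smul, Matrix.mulVec_smul, Matrix.mulVec_smul] at hc
    simp only [Matrix.add_mulVec, Matrix.smul_mulVec, Matrix.one_mulVec]
    ext i
    have := congrFun hc i
    simp at this ⊢
    linear_combination this

/-- The exponential estimate for the PID law with feedforward. -/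
theorem lawPID_estimate {R₀ : ℝ → Mat3} {Ω₀ u₀ : ℝ → Vec3} (href : IsReference R₀ Ω₀ u₀)
    {KP KD KI : Mat3} (hK : IsHurwitzPID KP KD KI) :
    HasExponentialEstimate R₀ Ω₀ u₀ (lawPID R₀ Ω₀ u₀ KP KD KI) := by
  obtain ⟨m, hm⟩ := href.bounded_Ω₀
  have hm0 : 0 ≤ m := (norm_nonneg _).trans (hm 0 le_rfl)
  obtain ⟨P, hPs, hP, η, hη, hPA⟩ := hK.isHurwitz_companion.exists_lyapunov
  refine hasExponentialEstimate_of_lyapunov href hPs (a := 1) (b := 2 + 2 * m ^ 2)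
    (m := (2 + 2 * m ^ 2)⁻¹) (η := η) (κ := 2 * (1 + m)) one_pos (by positivity) (by positivity) hη
    (by positivity) (by simpa using hP) fun t₀ T ht₀ hT R Ω hcl => ?_
  have h₀ := href.isTrajectory_Icc (T := T) ht₀
  have hsize : ∀ t ∈ Icc t₀ T, _ := fun t ht =>
    norm_sq_add_le_of_cross (z := Zk R₀ R t) (hm t (ht₀.trans ht.1)) (v := Ω t - Ω₀ t)
      (d := linRate R₀ Ω₀ R Ω t) rfl
  have hζ : ∀ t ∈ Icc t₀ T, HasDerivWithinAt (fun t => ∫ s in t₀..t, Zk R₀ R s) (Zk R₀ R t)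
      (Icc t₀ T) t := fun t ht => hasDerivWithinAt_integral_Icc
    (fun s hs => (hcl.hasDerivWithinAt_Zk h₀ hs).continuousWithinAt) ht
  refine ⟨fun t => Sum.elim (Sum.elim (∫ s in t₀..t, Zk R₀ R s) (Zk R₀ R t))
      (linRate R₀ Ω₀ R Ω t),
    fun t => companionPID KP KD KI *ᵥ
      Sum.elim (Sum.elim (∫ s in t₀..t, Zk R₀ R s) (Zk R₀ R t)) (linRate R₀ Ω₀ R Ω t),
    fun t => Sum.elim (Sum.elim 0 (attitudeRemainder R₀ Ω₀ R Ω t))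
      (attitudeRemainder R₀ Ω₀ R Ω t ⨯₃ Ω₀ t),
    ?_, fun t ht => ⟨?_, hPA _, ?_, ?_⟩⟩
  · simp only [dotProduct_self_eq_norm_sq, norm_sq_sumElim, intervalIntegral.integral_same,
      WithLp.toLp_zero, norm_zero, zero_pow two_ne_zero, zero_add]
    exact (hsize t₀ (left_mem_Icc.2 hT)).1
  · refine (((hζ t ht).sumElim (hcl.hasDerivWithinAt_Zk h₀ ht)).sumElim
      (hcl.hasDerivWithinAt_linRate h₀ ht)).congr_deriv ?_
    beta_reduce
    rw [companionPID_mulVec]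
    simp only [lawPID]
    ext ((i | i) | i) <;> simp
    ring
  · have h0 := norm_sumElim_le (0 : Vec3) (attitudeRemainder R₀ Ω₀ R Ω t)
    rw [WithLp.toLp_zero, norm_zero, zero_add] at h0
    have h1 := norm_attitudeRemainder_le (R := R) (Ω₀ := Ω₀) (Ω := Ω) (h₀.mem_SO3 t ht)
    have h2 : ‖attitudeRemainder R₀ Ω₀ R Ω t ⨯₃ Ω₀ t‖₂
        ≤ ‖attitudeRemainder R₀ Ω₀ R Ω t‖₂ * m :=
      (norm_cross_le _ _).trans (by gcongr; exact hm t (ht₀.trans ht.1))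
    refine (norm_sumElim_le _ _).trans ?_
    nlinarith
  · rw [inv_mul_le_iff₀ (by positivity)]
    simp only [dotProduct_self_eq_norm_sq, norm_sq_sumElim]
    refine (hsize t ht).2.trans (mul_le_mul_of_nonneg_left ?_ (by positivity))
    have := sq_nonneg ‖∫ s in t₀..t, Zk R₀ R s‖₂
    linarith

/-- The cross-term Lyapunov function `k |z|² + 2 ε z·ΔΩ + |ΔΩ|²` for laws without feedforward of
the reference acceleration. -/
theorem hasExponentialEstimate_of_crossTerm {R₀ : ℝ → Mat3} {Ω₀ u₀ : ℝ → Vec3}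
    (href : IsReference R₀ Ω₀ u₀) {F : FeedbackLaw} {G : ℝ → Vec3 → Vec3 → Vec3}
    {k ε l N : ℝ} (hk : 0 < k) (hε : 0 < ε) (hεk : ε ^ 2 < k)
    (hdisc : ε * (4 * k + N ^ 2) < 4 * k * l)
    (hF : ∀ t₀ R Ω t, F t₀ R Ω t = G t (Zk R₀ R t) (Ω t - Ω₀ t))
    (hG : ∀ t, 0 ≤ t → ∀ z w : Vec3,
      k * (z ⬝ᵥ w) + ε * (z ⬝ᵥ G t z w + w ⬝ᵥ (z ⨯₃ Ω₀ t + w)) + w ⬝ᵥ G t z w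
        ≤ -(l - ε) * ‖w‖₂ ^ 2 - ε * k * ‖z‖₂ ^ 2 + ε * N * (‖w‖₂ * ‖z‖₂)) :
    HasExponentialEstimate R₀ Ω₀ u₀ F := by
  have hl : 0 < l - ε := by
    have h1 : 4 * k * ε < 4 * k * l := by nlinarith [mul_nonneg hε.le (sq_nonneg N)]
    linarith [lt_of_mul_lt_mul_left h1 (by positivity)]
  obtain ⟨a, ha, hpos⟩ := exists_mul_add_le_of_discrim (α := k) (β := ε) (γ := 1) hk one_pos
    (by linarith)
  obtain ⟨η, hη, hneg⟩ := exists_mul_add_le_of_discrim (α := l - ε) (β := ε * N / 2) (γ := ε * k)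
    hl (by positivity) (by nlinarith [mul_lt_mul_of_pos_left hdisc hε])
  set P : Matrix (Fin 3 ⊕ Fin 3) (Fin 3 ⊕ Fin 3) ℝ :=
    Matrix.fromBlocks (k • 1) (ε • 1) (ε • 1) 1 with hP
  have hPx : ∀ a b c d : Vec3, Sum.elim a b ⬝ᵥ P *ᵥ Sum.elim c d
      = k * (a ⬝ᵥ c) + ε * (a ⬝ᵥ d + b ⬝ᵥ c) + b ⬝ᵥ d := by
    intro a b c d
    rw [hP, Matrix.fromBlocks_mulVec]
    simp only [Sum.elim_comp_inl, Sum.elim_comp_inr, Matrix.smul_mulVec, Matrix.one_mulVec,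
      sumElim_dotProduct_sumElim, dotProduct_add, dotProduct_smul, smul_eq_mul]
    ring
  refine hasExponentialEstimate_of_lyapunov href (P := P) ?_ (a := a) (b := 1) (m := 1)
    (η := 2 * η) (κ := 2) ha one_pos one_pos (by positivity) two_pos ?_ ?_
  · rw [hP, Matrix.fromBlocks_transpose]
    simp
  · intro x
    obtain ⟨z, w, rfl⟩ : ∃ z w : Vec3, x = Sum.elim z w :=
      ⟨x ∘ Sum.inl, x ∘ Sum.inr, (Sum.elim_comp_inl_inr x).symm⟩
    rw [hPx, dotProduct_self_eq_norm_sq, norm_sq_sumElim, dotProduct_self_eq_norm_sq,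
      dotProduct_self_eq_norm_sq, dotProduct_comm w z]
    have h1 := hpos ‖z‖₂ ‖w‖₂
    have h2 := mul_le_mul_of_nonneg_left (neg_le_of_abs_le (abs_dotProduct_le z w)) hε.le
    linarith
  · intro t₀ T ht₀ hT R Ω hcl
    have h₀ := href.isTrajectory_Icc (T := T) ht₀
    refine ⟨fun t => Sum.elim (Zk R₀ R t) (Ω t - Ω₀ t),
      fun t => Sum.elim (linRate R₀ Ω₀ R Ω t) (F t₀ R Ω t),
      fun t => Sum.elim (attitudeRemainder R₀ Ω₀ R Ω t) 0,
      ?_, fun t ht => ⟨?_, ?_, ?_, ?_⟩⟩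
    · simp only [dotProduct_self_eq_norm_sq, norm_sq_sumElim, one_mul, le_refl]
    · refine ((hcl.hasDerivWithinAt_Zk h₀ ht).sumElim
        (hcl.hasDerivWithinAt_sub h₀ ht)).congr_deriv ?_
      ext (i | i) <;> simp
    · beta_reduce
      rw [hPx, dotProduct_self_eq_norm_sq, norm_sq_sumElim, hF, linRate]
      have h1 := hG t (ht₀.trans ht.1) (Zk R₀ R t) (Ω t - Ω₀ t)
      have h2 := hneg ‖Ω t - Ω₀ t‖₂ ‖Zk R₀ R t‖₂
      rw [dotProduct_add (Zk R₀ R t), dot_self_cross, zero_add]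
      linarith
    · refine (norm_sumElim_le _ _).trans ?_
      rw [WithLp.toLp_zero, norm_zero, add_zero]
      exact norm_attitudeRemainder_le (h₀.mem_SO3 t ht)
    · simp only [dotProduct_self_eq_norm_sq, norm_sq_sumElim, one_mul, le_refl]

theorem exists_crossTerm_gain {k l : ℝ} (hk : 0 < k) (hl : 0 < l) (N : ℝ) :
    ∃ ε : ℝ, 0 < ε ∧ ε ^ 2 < k ∧ ε * (4 * k + N ^ 2) < 4 * k * l := by
  have h1 : 0 < 4 * k + N ^ 2 := by positivity
  obtain ⟨ε, hε, hlt⟩ := exists_between (a₁ := (0 : ℝ))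
    (a₂ := min (√k) (4 * k * l / (4 * k + N ^ 2))) (by positivity)
  refine ⟨ε, hε, (Real.lt_sqrt hε.le).1 (hlt.trans_le (min_le_left _ _)), ?_⟩
  exact (lt_div_iff₀ h1).1 (hlt.trans_le (min_le_right _ _))

section Spectrum

variable {K : Mat3}

theorem lambdaMin_mem_spectrum (hK : K.PosDef) : lambdaMin K ∈ spectrum ℝ K := by
  rw [lambdaMin, hK.isHermitian.spectrum_real_eq_range_eigenvalues]
  exact (range_nonempty _).csInf_mem (finite_range _)

theorem spectrum_pos (hK : K.PosDef) {x : ℝ} (hx : x ∈ spectrum ℝ K) : 0 < x := by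
  rw [hK.isHermitian.spectrum_real_eq_range_eigenvalues] at hx
  obtain ⟨i, rfl⟩ := hx
  exact hK.eigenvalues_pos i

theorem finite_spectrum (hK : K.PosDef) : (spectrum ℝ K).Finite := by
  rw [hK.isHermitian.spectrum_real_eq_range_eigenvalues]
  exact finite_range _

theorem lambdaMin_pos (hK : K.PosDef) : 0 < lambdaMin K :=
  spectrum_pos hK (lambdaMin_mem_spectrum hK)

theorem lambdaMax_pos (hK : K.PosDef) : 0 < lambdaMax K :=
  (lambdaMin_pos hK).trans_le
    (le_csSup (finite_spectrum hK).bddAbove (lambdaMin_mem_spectrum hK))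

theorem lambdaMin_mul_le (hK : K.PosDef) (w : Vec3) : lambdaMin K * ‖w‖₂ ^ 2 ≤ w ⬝ᵥ K *ᵥ w := by
  have hH : (K - algebraMap ℝ Mat3 (lambdaMin K)).IsHermitian := by
    refine hK.isHermitian.sub ?_
    rw [Algebra.algebraMap_eq_smul_one]
    simp [Matrix.IsHermitian]
  have hpsd : (K - algebraMap ℝ Mat3 (lambdaMin K)).PosSemidef := by
    rw [hH.posSemidef_iff_eigenvalues_nonneg]
    intro i
    have h1 : hH.eigenvalues i ∈ spectrum ℝ (K - algebraMap ℝ Mat3 (lambdaMin K)) := by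
      rw [hH.spectrum_real_eq_range_eigenvalues]
      exact mem_range_self i
    rw [spectrum.mem_iff] at h1
    have h2 : hH.eigenvalues i + lambdaMin K ∈ spectrum ℝ K := by
      rw [spectrum.mem_iff, map_add]
      convert h1 using 2
      abel
    have h3 := csInf_le (finite_spectrum hK).bddBelow h2
    simp only [Pi.zero_apply]
    rw [← lambdaMin] at h3
    linarith
  have h := hpsd.dotProduct_mulVec_nonneg w
  rw [Matrix.sub_mulVec, Algebra.algebraMap_eq_smul_one, Matrix.smul_mulVec, Matrix.one_mulVec,
    dotProduct_sub, dotProduct_smul, star_trivial, dotProduct_self_eq_norm_sq] at h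
  simpa using h

theorem dotProduct_mulVec_le_lambdaMax (hK : K.PosDef) (w : Vec3) :
    w ⬝ᵥ K *ᵥ w ≤ lambdaMax K * ‖w‖₂ ^ 2 := by
  have hH : (algebraMap ℝ Mat3 (lambdaMax K) - K).IsHermitian := by
    refine Matrix.IsHermitian.sub ?_ hK.isHermitian
    rw [Algebra.algebraMap_eq_smul_one]
    simp [Matrix.IsHermitian]
  have hpsd : (algebraMap ℝ Mat3 (lambdaMax K) - K).PosSemidef := by
    rw [hH.posSemidef_iff_eigenvalues_nonneg]
    intro i
    have h1 : hH.eigenvalues i ∈ spectrum ℝ (algebraMap ℝ Mat3 (lambdaMax K) - K) := by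
      rw [hH.spectrum_real_eq_range_eigenvalues]
      exact mem_range_self i
    rw [spectrum.mem_iff] at h1
    have h2 : lambdaMax K - hH.eigenvalues i ∈ spectrum ℝ K := by
      rw [spectrum.mem_iff, map_sub, ← IsUnit.neg_iff]
      convert h1 using 2
      abel
    have h3 := le_csSup (finite_spectrum hK).bddAbove h2
    simp only [Pi.zero_apply]
    rw [← lambdaMax] at h3
    linarith
  have h := hpsd.dotProduct_mulVec_nonneg w
  rw [Matrix.sub_mulVec, Algebra.algebraMap_eq_smul_one, Matrix.smul_mulVec, Matrix.one_mulVec,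
    dotProduct_sub, dotProduct_smul, star_trivial, dotProduct_self_eq_norm_sq] at h
  simpa using h

theorem norm_mulVec_le_lambdaMax (hK : K.PosDef) (w : Vec3) :
    ‖K *ᵥ w‖₂ ≤ lambdaMax K * ‖w‖₂ := by
  have hc := lambdaMax_pos hK
  set c := lambdaMax K with hcdef
  refine (sq_le_sq₀ (norm_nonneg _) (by positivity)).1 ?_
  have hsymm : ∀ a b : Vec3, a ⬝ᵥ K *ᵥ b = (K *ᵥ a) ⬝ᵥ b := by
    intro a b
    have hT : Kᵀ = K := by
      have := hK.isHermitian
      rwa [Matrix.IsHermitian, Matrix.conjTranspose_eq_transpose_of_trivial] at this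
    rw [Matrix.dotProduct_mulVec, ← Matrix.mulVec_transpose, hT]
  have h1 := hK.posSemidef.dotProduct_mulVec_nonneg (c • w - K *ᵥ w)
  rw [star_trivial, Matrix.mulVec_sub, Matrix.mulVec_smul, sub_dotProduct, dotProduct_sub,
    dotProduct_sub, smul_dotProduct, smul_dotProduct, dotProduct_smul, dotProduct_smul,
    hsymm w (K *ᵥ w), dotProduct_self_eq_norm_sq] at h1
  have h2 := dotProduct_mulVec_le_lambdaMax hK (K *ᵥ w)
  have h3 := dotProduct_mulVec_le_lambdaMax hK w
  simp only [smul_eq_mul] at h1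
  rw [← hcdef] at h2 h3
  have h4 : c * ‖K *ᵥ w‖₂ ^ 2 ≤ c * (c * (w ⬝ᵥ K *ᵥ w)) := by linarith
  have h5 := le_of_mul_le_mul_left h4 hc
  calc ‖K *ᵥ w‖₂ ^ 2 ≤ c * (w ⬝ᵥ K *ᵥ w) := h5
    _ ≤ c * (c * ‖w‖₂ ^ 2) := by gcongr
    _ = (c * ‖w‖₂) ^ 2 := by ring

end Spectrum

theorem abs_dotProduct_le_of_norm_le {z v : Vec3} {a b : ℝ} (h : ‖v‖₂ ≤ a * b) :
    |z ⬝ᵥ v| ≤ a * (b * ‖z‖₂) := by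
  refine (abs_dotProduct_le z v).trans ?_
  calc ‖z‖₂ * ‖v‖₂ ≤ ‖z‖₂ * (a * b) := by gcongr
    _ = _ := by ring

theorem abs_dotProduct_cross_le {w z v : Vec3} {m : ℝ} (hv : ‖v‖₂ ≤ m) :
    |w ⬝ᵥ z ⨯₃ v| ≤ m * (‖w‖₂ * ‖z‖₂) := by
  refine (abs_dotProduct_le w _).trans ?_
  calc ‖w‖₂ * ‖z ⨯₃ v‖₂ ≤ ‖w‖₂ * (‖z‖₂ * m) := by
        gcongr
        exact (norm_cross_le z v).trans (by gcongr)
    _ = _ := by ring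

theorem lawSimple_estimate {R₀ : ℝ → Mat3} {Ω₀ u₀ : ℝ → Vec3} (href : IsReference R₀ Ω₀ u₀)
    {kP : ℝ} {KD : Mat3} (hk : 0 < kP) (hK : KD.PosDef) :
    HasExponentialEstimate R₀ Ω₀ u₀ (lawSimple R₀ Ω₀ kP KD) := by
  obtain ⟨m, hm⟩ := href.bounded_Ω₀
  obtain ⟨ε, hε, hε1, hε2⟩ := exists_crossTerm_gain hk (lambdaMin_pos hK) (lambdaMax KD + m)
  refine hasExponentialEstimate_of_crossTerm href (G := fun _ z w => -(kP • z) - KD *ᵥ w) hk hε hε1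
    hε2 (fun _ _ _ _ => rfl) fun t ht z w => ?_
  have h1 := lambdaMin_mul_le hK w
  have h2 := neg_le_of_abs_le
    (abs_dotProduct_le_of_norm_le (z := z) (norm_mulVec_le_lambdaMax hK w))
  have h3 := le_of_abs_le (abs_dotProduct_cross_le (w := w) (z := z) (hm t ht))
  have h4 := mul_le_mul_of_nonneg_left (add_le_add h3 (neg_le.1 h2)) hε.le
  simp only [dotProduct_add, dotProduct_sub, dotProduct_neg, dotProduct_smul, smul_eq_mul,
    dotProduct_self_eq_norm_sq, dotProduct_comm w z]
  linarith

theorem lawEps_estimate {R₀ : ℝ → Mat3} {Ω₀ u₀ : ℝ → Vec3} (href : IsReference R₀ Ω₀ u₀)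
    {kP ε : ℝ} {KD : Mat3} (hk : 0 < kP) (hK : KD.PosDef) (hε : 0 < ε)
    (hlt : ε < min (√kP) (4 * kP * lambdaMin KD / (4 * kP + lambdaMax KD ^ 2))) :
    HasExponentialEstimate R₀ Ω₀ u₀ (lawEps R₀ Ω₀ kP ε KD) := by
  refine hasExponentialEstimate_of_crossTerm href
    (G := fun t z w => -(kP • z) - KD *ᵥ w - ε • (z ⨯₃ Ω₀ t)) (N := lambdaMax KD) hk hε
    ((Real.lt_sqrt hε.le).1 (hlt.trans_le (min_le_left _ _)))
    ((lt_div_iff₀ (by positivity)).1 (hlt.trans_le (min_le_right _ _)))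
    (fun _ _ _ _ => rfl) fun t ht z w => ?_
  have h1 := lambdaMin_mul_le hK w
  have h2 := neg_le_of_abs_le
    (abs_dotProduct_le_of_norm_le (z := z) (norm_mulVec_le_lambdaMax hK w))
  have h4 := mul_le_mul_of_nonneg_left (neg_le.1 h2) hε.le
  simp only [dotProduct_add, dotProduct_sub, dotProduct_neg, dotProduct_smul, smul_eq_mul,
    dotProduct_self_eq_norm_sq, dotProduct_comm w z, dot_self_cross]
  linarith

theorem lawGeom_estimate {R₀ : ℝ → Mat3} {Ω₀ u₀ : ℝ → Vec3} (href : IsReference R₀ Ω₀ u₀)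
    {kR kΩ : ℝ} (hk : 0 < kR) (hkΩ : 0 < kΩ) :
    HasExponentialEstimate R₀ Ω₀ u₀ (lawGeom R₀ Ω₀ kR kΩ) := by
  obtain ⟨m, hm⟩ := href.bounded_Ω₀
  obtain ⟨ε, hε, hε1, hε2⟩ := exists_crossTerm_gain hk hkΩ (kΩ + 2 * m)
  refine hasExponentialEstimate_of_crossTerm href
    (G := fun t z w => -(kR • z) - kΩ • w + w ⨯₃ Ω₀ t) hk hε hε1 hε2
    (fun _ _ _ _ => rfl) fun t ht z w => ?_
  have h1 := mul_le_mul_of_nonneg_left (neg_le.1 (neg_le_of_abs_le (abs_dotProduct_le z w))) hkΩ.le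
  have h2 := le_of_abs_le (abs_dotProduct_cross_le (w := z) (z := w) (hm t ht))
  have h3 := le_of_abs_le (abs_dotProduct_cross_le (w := w) (z := z) (hm t ht))
  have h4 := mul_le_mul_of_nonneg_left (add_le_add (add_le_add h2 h3) h1) hε.le
  simp only [dotProduct_add, dotProduct_sub, dotProduct_neg, dotProduct_smul, smul_eq_mul,
    dotProduct_self_eq_norm_sq, dotProduct_comm w z, dot_self_cross]
  linarith

theorem cross_eq_neg_hat_mulVec (v w : Vec3) : v ⨯₃ w = -(hat w *ᵥ v) := by
  rw [hat_mulVec, cross_anticomm]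

theorem feedforward_eq (KP KD : Mat3) (z v w w' : Vec3) :
    -(KP *ᵥ z) - KD *ᵥ (z ⨯₃ w + v) - (z ⨯₃ w + v) ⨯₃ w - z ⨯₃ w'
      = (-KP + KD * hat w - hat w * hat w + hat w') *ᵥ z + (-KD + hat w) *ᵥ v := by
  simp only [cross_eq_neg_hat_mulVec, Matrix.add_mulVec, Matrix.sub_mulVec, Matrix.neg_mulVec,
    Matrix.mulVec_add, Matrix.mulVec_neg, ← Matrix.mulVec_mulVec]
  abel

end RigidBody

open RigidBody in
theorem mainTheorem5 (R₀ : ℝ → RigidBody.Mat3) (Ω₀ u₀ : ℝ → RigidBody.Vec3)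
    (href : RigidBody.IsReference R₀ Ω₀ u₀) :
    (∀ KP KD : RigidBody.Mat3,
      RigidBody.IsHurwitz (Matrix.fromBlocks 0 1 (-KP) (-KD)) →
      RigidBody.ExponentiallyTracks R₀ Ω₀ u₀ (RigidBody.lawPD R₀ Ω₀ u₀ KP KD)) ∧
    (∀ KP KD KI : RigidBody.Mat3,
      RigidBody.IsHurwitzPID KP KD KI →
      RigidBody.ExponentiallyTracks R₀ Ω₀ u₀ (RigidBody.lawPID R₀ Ω₀ u₀ KP KD KI)) ∧
    (∀ (kP : ℝ) (KD : RigidBody.Mat3), 0 < kP → KD.PosDef →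
      RigidBody.ExponentiallyTracks R₀ Ω₀ u₀ (RigidBody.lawSimple R₀ Ω₀ kP KD)) ∧
    (∀ (kP ε : ℝ) (KD : RigidBody.Mat3), 0 < kP → KD.PosDef → 0 < ε →
      ε < min (√kP) (4 * kP * RigidBody.lambdaMin KD / (4 * kP + RigidBody.lambdaMax KD ^ 2)) →
      RigidBody.ExponentiallyTracks R₀ Ω₀ u₀ (RigidBody.lawEps R₀ Ω₀ kP ε KD)) ∧
    (∀ kR kΩ : ℝ, 0 < kR → 0 < kΩ →
      RigidBody.ExponentiallyTracks R₀ Ω₀ u₀ (RigidBody.lawGeom R₀ Ω₀ kR kΩ)) := by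
  have hΩ := IsAdmissibleGain.hat href.isTrajectory.continuousOn_Ω href.bounded_Ω₀
  have hu := IsAdmissibleGain.hat href.continuousOn_u₀ href.bounded_u₀
  have hc := IsAdmissibleGain.const
  have hA : ∀ KP KD : Mat3, IsAdmissibleGain fun t =>
      -KP + KD * hat (Ω₀ t) - hat (Ω₀ t) * hat (Ω₀ t) + hat (u₀ t) := fun KP KD =>
    (((hc (-KP)).add ((hc KD).mul hΩ)).sub (hΩ.mul hΩ)).add hu
  refine ⟨fun KP KD hK => ?_, fun KP KD KI hK => ?_, fun kP KD hk hK => ?_,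
    fun kP ε KD hk hK hε hlt => ?_, fun kR kΩ hk hkΩ => ?_⟩
  · refine (lawPD_estimate href hK).exponentiallyTracks href (hA KP KD) ((hc (-KD)).add hΩ)
      (K := 0) fun t₀ R Ω t => ?_
    rw [lawPD, linRate, feedforward_eq, Matrix.zero_mulVec, add_zero]
  · refine (lawPID_estimate href hK).exponentiallyTracks href (hA KP KD) ((hc (-KD)).add hΩ)
      (K := -KI) fun t₀ R Ω t => ?_
    rw [← feedforward_eq, Matrix.neg_mulVec, lawPID, linRate]
    abel
  · refine (lawSimple_estimate href hk hK).exponentiallyTracks href (hc (-(kP • 1))) (hc (-KD))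
      (K := 0) fun t₀ R Ω t => ?_
    simp only [lawSimple, Matrix.neg_mulVec, Matrix.smul_mulVec, Matrix.one_mulVec,
      Matrix.zero_mulVec]
    abel
  · refine (lawEps_estimate href hk hK hε hlt).exponentiallyTracks href
      ((hc (-(kP • 1))).add ((hc (ε • 1)).mul hΩ)) (hc (-KD)) (K := 0) fun t₀ R Ω t => ?_
    simp only [lawEps, Matrix.neg_mulVec, Matrix.smul_mulVec, Matrix.one_mulVec, Matrix.add_mulVec,
      Matrix.zero_mulVec, cross_eq_neg_hat_mulVec, ← Matrix.mulVec_mulVec, smul_neg]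
    abel
  · refine (lawGeom_estimate href hk hkΩ).exponentiallyTracks href (hc (-(kR • 1)))
      ((hc (-(kΩ • 1))).sub hΩ) (K := 0) fun t₀ R Ω t => ?_
    simp only [lawGeom, Matrix.neg_mulVec, Matrix.smul_mulVec, Matrix.one_mulVec, Matrix.sub_mulVec,
      Matrix.zero_mulVec, cross_eq_neg_hat_mulVec]
    abel
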